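/- **Setting.** Let $N=[n]$ ($n\ge 1$) be a set of agents partitioned into color classes $D_1,\dots,D_\gamma$ (empty classes are allowed). The palette of a nonempty $X\subseteq N$ is the tuple $\left(|D_c\cap X|/|X|\right)_{c\in[\gamma]}$. Every agent $i$ has a weak order (a total, transitive relation) $\succeq_i$ on the set of palettes of nonempty subsets of $N$, with strict part $\succ_i$; nonempty coalitions are compared through their palettes. An outcome is a partition $\Pi$ of $N$ into nonempty coalitions, and $\Pi_i$ is the coalition of $\Pi$ that contains $i$. An agent $i$ admits an NS-deviation to $C\in\Pi\cup\{\emptyset\}$ if $C\cup\{i\}\succ_i\Pi_i$; this is an IS-deviation if moreover $C\cup\{i\}\succeq_j C$ for all $j\in C$. The outcome $\Pi$ is Nash stable (individually stable) if no agent admits an NS-deviation (an IS-deviation). **Problems.** An instance of HDG-Nash consists of the agents, their colors, the preferences, and integers $\sigma,\rho,\rho'\ge 0$. The question is whether there is a Nash-stable outcome with at most $\rho$ coalitions and at most $\rho'$ coalitions of size different from $1$, in which every coalition has size at most $\sigma$. HDG-Individual is the same problem with individually stable in place of Nash stable. **Computational model.** The preferences are not part of the explicit input: an oracle tells, in constant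 time, for an agent $i$ and two nonempty coalitions $C,C'\subseteq N$, whether $C\succeq_i C'$. Algorithms are programs of a random access machine that has access to this oracle, and whose unit-cost operations are reading and writing memory cells, addition and truncated subtraction of natural numbers, and tests for zero. **Theorem.** HDG-Nash and HDG-Individual are both fixed-parameter tractable parameterized by $\gamma+\sigma$, the number of colors plus the maximum coalition size. That is, for each of the two problems there are a single algorithm, a computable function $f:\mathbb N\to\mathbb N$ and a constant $c$ such that the algorithm correctly decides every instance in time at most $f(\gamma+\sigma)\cdot n^{c}$, where $n$ is the number of agents. -/

import Mathlib

namespace HDG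

/-! ### Hedonic diversity games -/

/-- The palette of a set `X` of agents: for every color `c` the fraction of members of `X` that
have color `c`. Only meaningful for nonempty `X`, and only used for such `X`. -/
def palette {n γ : ℕ} (color : Fin n → Fin γ) (X : Finset (Fin n)) : Fin γ → ℚ :=
  fun c => ((X.filter fun i => color i = c).card : ℚ) / (X.card : ℚ)

/-- The palettes over which preferences are expressed: those of the nonempty sets of agents. -/
def Palette {n γ : ℕ} (color : Fin n → Fin γ) : Type :=
  {p : Fin γ → ℚ // ∃ X : Finset (Fin n), X.Nonempty ∧ palette color X = p}

/-- An instance. Agents are `0, …, n - 1`, colors are `0, …, γ - 1`, and the color class of `c`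
is `{i | color i = c}` (a color class may be empty). -/
structure Instance where
  /-- number of agents -/
  n : ℕ
  n_pos : 0 < n
  /-- number of colors -/
  γ : ℕ
  color : Fin n → Fin γ
  /-- `pref i p q` says that agent `i` weakly prefers palette `p` to palette `q` -/
  pref : Fin n → Palette color → Palette color → Prop
  pref_total : ∀ i p q, pref i p q ∨ pref i q p
  pref_trans : ∀ i p q r, pref i p q → pref i q r → pref i p r
  /-- maximum size of a coalition -/
  maxSize : ℕ
  /-- maximum number of coalitions -/
  maxCoalitions : ℕ
  /-- maximum number of non-trivial coalitions -/
  maxNontrivial : ℕ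

namespace Instance

variable (I : Instance)

/-- Agent `i` weakly prefers coalition `C` to coalition `D` (both nonempty). -/
def WeaklyPrefers (i : Fin I.n) (C D : Finset (Fin I.n)) : Prop :=
  ∃ (hC : C.Nonempty) (hD : D.Nonempty),
    I.pref i ⟨palette I.color C, C, hC, rfl⟩ ⟨palette I.color D, D, hD, rfl⟩

/-- Agent `i` strictly prefers coalition `C` to coalition `D`. -/
def StrictlyPrefers (i : Fin I.n) (C D : Finset (Fin I.n)) : Prop :=
  I.WeaklyPrefers i C D ∧ ¬ I.WeaklyPrefers i D C

/-- An outcome: a partition of the set of all agents into nonempty coalitions. -/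
abbrev Outcome : Type := Finpartition (Finset.univ : Finset (Fin I.n))

variable {I}

/-- Agent `i` admits an NS-deviation to `C`, where `C` is a coalition of the outcome or empty. -/
def NSDeviation (P : I.Outcome) (i : Fin I.n) (C : Finset (Fin I.n)) : Prop :=
  (C ∈ P.parts ∨ C = ∅) ∧ I.StrictlyPrefers i (insert i C) (P.part i)

/-- An NS-deviation is an IS-deviation if moreover no member of `C` objects. -/
def ISDeviation (P : I.Outcome) (i : Fin I.n) (C : Finset (Fin I.n)) : Prop :=
  NSDeviation P i C ∧ ∀ j ∈ C, I.WeaklyPrefers j (insert i C) C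

def NashStable (P : I.Outcome) : Prop := ∀ i C, ¬ NSDeviation P i C

def IndividuallyStable (P : I.Outcome) : Prop := ∀ i C, ¬ ISDeviation P i C

/-- The outcome obeys the three bounds that are part of the instance. -/
def Admissible (P : I.Outcome) : Prop :=
  P.parts.card ≤ I.maxCoalitions ∧
  (P.parts.filter fun C => C.card ≠ 1).card ≤ I.maxNontrivial ∧
  ∀ C ∈ P.parts, C.card ≤ I.maxSize

end Instance

/-- The decision problem for Nash stability. -/
def NashProblem (I : Instance) : Prop :=
  ∃ P : I.Outcome, Instance.NashStable P ∧ Instance.Admissible P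

/-- The decision problem for individual stability. -/
def IndividualProblem (I : Instance) : Prop :=
  ∃ P : I.Outcome, Instance.IndividuallyStable P ∧ Instance.Admissible P

/-! ### Oracle random access programs

A program works on finitely many arrays of natural numbers (array `A`, cell `j` holds `s A j`).
Instructions are the classical ones of a random access machine with unit cost: constants,
indirect reads and writes, addition and truncated subtraction, tests against zero, and queries
to an oracle. There is no multiplication, so unit cost is polynomially related to bit cost. -/

/-- The memory of the machine. -/
abbrev Memory : Type := ℕ → ℕ → ℕ

inductive Expr : Type
  | const (v : ℕ)
  | read (A : ℕ) (idx : Expr)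
  | add (a b : Expr)
  | sub (a b : Expr)

namespace Expr

def eval (s : Memory) : Expr → ℕ
  | const v => v
  | read A idx => s A (idx.eval s)
  | add a b => a.eval s + b.eval s
  | sub a b => a.eval s - b.eval s

/-- The time to evaluate an expression: one unit for every operation. -/
def cost : Expr → ℕ
  | const _ => 1
  | read _ idx => idx.cost + 1
  | add a b => a.cost + b.cost + 1
  | sub a b => a.cost + b.cost + 1

end Expr

/-- A contiguous piece of an array: array name, first cell, number of cells. -/
structure Segment : Type where
  array : ℕ
  start : Expr
  length : Expr

namespace Segment

def eval (s : Memory) (g : Segment) : List ℕ :=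
  (List.range (g.length.eval s)).map fun j => s g.array (g.start.eval s + j)

/-- The time to evaluate the two bounds of the segment. -/
def cost (g : Segment) : ℕ := g.start.cost + g.length.cost

end Segment

inductive Program : Type
  | skip
  /-- write `val` into cell `idx` of array `A` -/
  | write (A : ℕ) (idx val : Expr)
  | seq (p q : Program)
  /-- run `p` if `e` is nonzero and `q` otherwise -/
  | ite (e : Expr) (p q : Program)
  /-- repeat `p` as long as `e` is nonzero -/
  | loop (e : Expr) (p : Program)
  /-- ask the oracle about an agent and two coalitions listed in memory, and write the answer
  into cell `idx` of array `A` -/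
  | query (A : ℕ) (idx agent : Expr) (C D : Segment)

/-- Writing a value into a cell. -/
def Memory.set (s : Memory) (A j v : ℕ) : Memory :=
  Function.update s A (Function.update (s A) j v)

/-- `Exec O p s t s'`: with oracle `O`, program `p` started in memory `s` halts after exactly `t`
time units with memory `s'`. -/
inductive Exec (O : ℕ → List ℕ → List ℕ → ℕ) : Program → Memory → ℕ → Memory → Prop
  | skip (s : Memory) : Exec O .skip s 1 s
  | write (A : ℕ) (idx val : Expr) (s : Memory) :
      Exec O (.write A idx val) s (idx.cost + val.cost + 1) (s.set A (idx.eval s) (val.eval s))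
  | seq {p q : Program} {s s' s'' : Memory} {t t' : ℕ} :
      Exec O p s t s' → Exec O q s' t' s'' → Exec O (.seq p q) s (t + t') s''
  | ite_true {e : Expr} {p q : Program} {s s' : Memory} {t : ℕ} :
      e.eval s ≠ 0 → Exec O p s t s' → Exec O (.ite e p q) s (e.cost + 1 + t) s'
  | ite_false {e : Expr} {p q : Program} {s s' : Memory} {t : ℕ} :
      e.eval s = 0 → Exec O q s t s' → Exec O (.ite e p q) s (e.cost + 1 + t) s'
  | loop_done {e : Expr} {p : Program} {s : Memory} :
      e.eval s = 0 → Exec O (.loop e p) s (e.cost + 1) s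
  | loop_step {e : Expr} {p : Program} {s s' s'' : Memory} {t t' : ℕ} :
      e.eval s ≠ 0 → Exec O p s t s' → Exec O (.loop e p) s' t' s'' →
      Exec O (.loop e p) s (e.cost + 1 + t + t') s''
  | query (A : ℕ) (idx agent : Expr) (C D : Segment) (s : Memory) :
      Exec O (.query A idx agent C D) s (idx.cost + agent.cost + C.cost + D.cost + 1)
        (s.set A (idx.eval s) (O (agent.eval s) (C.eval s) (D.eval s)))

/-- Execution is deterministic. -/
theorem Exec.deterministic {O : ℕ → List ℕ → List ℕ → ℕ} {p : Program} {s s' s2 : Memory}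
    {t t2 : ℕ} (h : Exec O p s t s') (h2 : Exec O p s t2 s2) :
    t = t2 ∧ s' = s2 := by
  induction h generalizing t2 s2 with
  | skip | write | query => cases h2; simp
  | seq _ _ i1 i2 => cases h2 with | seq a b => obtain ⟨rfl, rfl⟩ := i1 a; obtain ⟨rfl, rfl⟩ := i2 b; simp
  | ite_true h _ i1 => cases h2 with
    | ite_true _ a => obtain ⟨rfl, rfl⟩ := i1 a; simp
    | ite_false h' _ => exact absurd h' h
  | ite_false h _ i1 => cases h2 with
    | ite_false _ a => obtain ⟨rfl, rfl⟩ := i1 a; simp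
    | ite_true h' _ => exact absurd h h'
  | loop_done h => cases h2 with
    | loop_done => simp
    | loop_step h' => exact absurd h h'
  | loop_step h _ _ i1 i2 => cases h2 with
    | loop_done h' => exact absurd h' h
    | loop_step _ a b => obtain ⟨rfl, rfl⟩ := i1 a; obtain ⟨rfl, rfl⟩ := i2 b; simp

namespace Instance

variable (I : Instance)

/-- The set of agents listed by a list of numbers. -/
def coalition (L : List ℕ) : Finset (Fin I.n) :=
  Finset.univ.filter fun i => (i : ℕ) ∈ L

open Classical in
/-- The preference oracle: the answer is `1` if the given agent weakly prefers the first
(nonempty) coalition to the second, and `0` otherwise. -/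
noncomputable def oracle (a : ℕ) (L L' : List ℕ) : ℕ :=
  if ∃ h : a < I.n, I.WeaklyPrefers ⟨a, h⟩ (I.coalition L) (I.coalition L') then 1 else 0

/-- The input as presented to a program: array `0` holds the numbers of agents and colors and the
three bounds, array `1` the colors of the agents, and everything else is zero. The preferences
are accessible only through the oracle. -/
def input : Memory := fun A j =>
  if A = 0 then [I.n, I.γ, I.maxSize, I.maxCoalitions, I.maxNontrivial].getD j 0
  else if A = 1 then (if h : j < I.n then (I.color ⟨j, h⟩ : ℕ) else 0)
  else 0

end Instance

/-- The decision problem `Q` is fixed-parameter tractable with respect to the parameter `κ`: one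
program decides all instances, leaving the answer (`1` for yes, `0` for no) in cell `0` of array
`2`, within `f (κ I) * n ^ c` time units, `f` computable, where `n` is the number of agents (which
is at most the size of the input). -/
def FixedParameterTractable (Q : Instance → Prop) (κ : Instance → ℕ) : Prop :=
  ∃ (p : Program) (f : ℕ → ℕ) (c : ℕ), Computable f ∧
    ∀ I : Instance, ∃ (t : ℕ) (s : Memory),
      Exec I.oracle p I.input t s ∧ t ≤ f (κ I) * I.n ^ c ∧
      (Q I → s 2 0 = 1) ∧ (¬ Q I → s 2 0 = 0)

end HDG

namespace HDG
open Finset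

/-! Only coalitions of size at most σ occur in an admissible outcome, and a deviation creates one of
size at most σ + 1. An agent therefore matters only through its color and its preferences between
color-count vectors ("profiles") with entries at most σ + 1. This is its kind, and the number of
kinds is bounded in γ and σ. The kinds of the members of a coalition, with multiplicity, form its
configuration; these are bounded in number too. An outcome is determined, as far as the problem is
concerned, by how many coalitions have each configuration (`sum_confCount_coef`, `exists_outcome`).

Stability depends on these multiplicities only through their values capped at 2: a deviation needs a
coalition of the source configuration and one of the target configuration, and two of them if the
configurations agree (`stableCode_iff`). The question becomes an integer program: choose a stable
capped vector g and extra multiplicities y, supported where g equals 2, such that the agents of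
every kind are used up exactly and the two counting bounds hold (`solvable_iff`).

The coefficients and the number of unknowns are bounded in the parameter; only the right-hand side
grows with n. The program is solved by an automaton that guesses the binary digits of y from the
lowest level upwards and remembers g and a vector of carries. Carries stay bounded in the parameter,
so there are boundedly many states, and the subset construction decides solvability after n levels,
because the right-hand side is at most n < 2 ^ n (`accepting_reach_iff`).

For the running time, everything that depends on the parameter alone (initial set, transition,
acceptance) is primitive recursive, and every primitive recursive function has a program with a
primitive recursive time bound (`compilable_of_primrec`). No such program needs to be written by
hand. The hand-written part computes the kinds by oracle queries on representative coalitions,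
counts them, and feeds their binary digits to the automaton; its loops cost a polynomial in n times
a function of the parameter (`total_time_le`). -/

/-! ### Digits -/

/-- The digit of `x` at position `i` in base `b`. -/
def dig (b x i : ℕ) : ℕ := x / b ^ i % b

/-- The number with base `b` digits `f 0, …, f (m - 1)`. -/
def ofDig (b : ℕ) (f : ℕ → ℕ) (m : ℕ) : ℕ := ∑ i ∈ range m, f i * b ^ i

theorem ofDig_succ_bot (b : ℕ) (f : ℕ → ℕ) (m : ℕ) :
    ofDig b f (m + 1) = f 0 + b * ofDig b (fun i => f (i + 1)) m := by
  simp only [ofDig, Finset.sum_range_succ', pow_zero, mul_one, Finset.mul_sum]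
  rw [add_comm]
  congr 1
  exact Finset.sum_congr rfl fun i _ => by ring

theorem ofDig_congr {b : ℕ} {f g : ℕ → ℕ} {m : ℕ} (h : ∀ i < m, f i = g i) :
    ofDig b f m = ofDig b g m :=
  Finset.sum_congr rfl fun i hi => by rw [h i (by simpa using hi)]

theorem ofDig_lt {b : ℕ} {f : ℕ → ℕ} : ∀ {m : ℕ}, (∀ i < m, f i < b) → ofDig b f m < b ^ m
  | 0, _ => by simp [ofDig]
  | m + 1, h => by
    have h1 := ofDig_lt (m := m) fun i hi => h i (by omega)
    have h2 : f m + 1 ≤ b := h m (by omega)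
    have h3 : (f m + 1) * b ^ m ≤ b * b ^ m := Nat.mul_le_mul_right _ h2
    have h4 : ofDig b f (m + 1) = ofDig b f m + f m * b ^ m := by
      simp [ofDig, Finset.sum_range_succ]
    rw [h4, pow_succ]
    linarith [Nat.mul_comm b (b ^ m), Nat.add_mul (f m) 1 (b ^ m)]

theorem ofDig_add_div (b : ℕ) {f : ℕ → ℕ} {m : ℕ} (h : ∀ i < m, f i < b) (a : ℕ) :
    (ofDig b f m + b ^ m * a) / b ^ m = a := by
  have h1 := ofDig_lt h
  rw [Nat.add_mul_div_left _ _ (by omega), Nat.div_eq_of_lt h1, zero_add]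

theorem dig_ofDig_add {b : ℕ} (a : ℕ) : ∀ {m : ℕ} {f : ℕ → ℕ}, (∀ i < m, f i < b) →
    ∀ {i : ℕ}, i < m → dig b (ofDig b f m + b ^ m * a) i = f i
  | m + 1, f, h, i, hi => by
    have hb : 0 < b := (Nat.zero_le _).trans_lt (h 0 (by omega))
    have e : ofDig b f (m + 1) + b ^ (m + 1) * a
        = f 0 + b * (ofDig b (fun i => f (i + 1)) m + b ^ m * a) := by
      rw [ofDig_succ_bot]; ring
    rw [dig, e]
    cases i with
    | zero => simp [Nat.mod_eq_of_lt (h 0 (by omega))]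
    | succ i =>
      rw [pow_succ', ← Nat.div_div_eq_div_mul, Nat.add_mul_div_left _ _ hb,
        Nat.div_eq_of_lt (h 0 (by omega)), zero_add]
      exact dig_ofDig_add (f := fun i => f (i + 1)) a (fun j hj => h _ (by omega)) (by omega)

theorem dig_ofDig {b : ℕ} {m : ℕ} {f : ℕ → ℕ} (h : ∀ i < m, f i < b) {i : ℕ} (hi : i < m) :
    dig b (ofDig b f m) i = f i := by
  simpa using dig_ofDig_add 0 h hi

theorem dig_lt {b : ℕ} (hb : 0 < b) (x i : ℕ) : dig b x i < b := Nat.mod_lt _ hb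

/-- The number whose binary digits are `f p, …, f (p + d - 1)` with `a` above them. -/
def bits (f : ℕ → ℕ) (a : ℕ) : ℕ → ℕ → ℕ
  | _, 0 => a
  | p, d + 1 => f p + 2 * bits f a (p + 1) d

/-- The recursion matches the way a program accumulates bits by doubling; the closed form gives
access to single digits and to the part above them. -/
theorem bits_eq (f : ℕ → ℕ) (a p d : ℕ) :
    bits f a p d = ofDig 2 (fun i => f (p + i)) d + 2 ^ d * a := by
  induction d generalizing p with
  | zero => simp [bits, ofDig]
  | succ d ih =>
    rw [bits, ih, ofDig_succ_bot]
    simp only [add_zero, pow_succ, Nat.add_assoc, Nat.add_comm 1]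
    ring

open Classical in
/-- The number whose set bits are the `i < m` with `p i`. -/
noncomputable def bitset (p : ℕ → Prop) (m : ℕ) : ℕ := ofDig 2 (fun i => if p i then 1 else 0) m

theorem bitset_lt (p : ℕ → Prop) (m : ℕ) : bitset p m < 2 ^ m :=
  ofDig_lt fun i _ => by split_ifs <;> omega

theorem dig_bitset {p : ℕ → Prop} {m i : ℕ} (hi : i < m) : dig 2 (bitset p m) i = 1 ↔ p i := by
  rw [bitset, dig_ofDig (fun i _ => by split_ifs <;> omega) hi]
  split_ifs <;> simp_all

/-! ### Parameters of the integer program -/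

section
variable (γ σ : ℕ)

/-- Digits run up to σ + 1, not σ, because a deviating agent may enlarge a coalition of size σ. -/
def numProf : ℕ := (σ + 2) ^ γ
-- The low binary digits of a kind form the matrix of weak preferences between profiles, and the
-- quotient above them is the color.
def numKind : ℕ := γ * 2 ^ (numProf γ σ * numProf γ σ)
-- The two extra rows carry the bounds on all coalitions and on those of size different from 1.
def numRow : ℕ := numKind γ σ + 2
def numConf : ℕ := (σ + 1) ^ numKind γ σ

/-- The color of a kind. -/
def kindColor (A : ℕ) : ℕ := A / 2 ^ (numProf γ σ * numProf γ σ)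

/-- Agents of kind `A` strictly prefer profile `v` to profile `w`. -/
def KindStrict (A v w : ℕ) : Prop :=
  dig 2 A (v * numProf γ σ + w) = 1 ∧ dig 2 A (w * numProf γ σ + v) ≠ 1

/-- The number of members of a configuration. -/
def confSize (a : ℕ) : ℕ := ∑ A ∈ range (numKind γ σ), dig (σ + 1) a A

/-- The profile of a configuration. -/
def confProf (a : ℕ) : ℕ :=
  ∑ A ∈ range (numKind γ σ), dig (σ + 1) a A * (σ + 2) ^ kindColor γ σ A

/-- The coefficient of configuration `a` in row `r`. -/
def coef (a r : ℕ) : ℕ :=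
  if r < numKind γ σ then dig (σ + 1) a r
  else if r = numKind γ σ then 1
  else if confSize γ σ a = 1 then 0 else 1

/-- An agent of kind `A` in a coalition of configuration `a` wants to join a coalition of
configuration `b` (and, if `mode` is nonzero, is accepted). -/
def ConfDeviation (mode a A b : ℕ) : Prop :=
  KindStrict γ σ A (confProf γ σ b + (σ + 2) ^ kindColor γ σ A) (confProf γ σ a) ∧
  (mode = 0 ∨ ∀ B < numKind γ σ, dig (σ + 1) b B ≠ 0 →
    dig 2 B ((confProf γ σ b + (σ + 2) ^ kindColor γ σ A) * numProf γ σ + confProf γ σ b) = 1)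

/-- The capped multiplicities with code `g` are those of a stable outcome. -/
def StableCode (mode g : ℕ) : Prop :=
  ∀ a < numConf γ σ, dig 3 g a ≠ 0 →
    (confSize γ σ a ≠ 0 ∧ confSize γ σ a ≤ σ) ∧
    ∀ A < numKind γ σ, dig (σ + 1) a A ≠ 0 → ∀ b < numConf γ σ,
      -- Configuration 0 is the empty coalition, always available as a target. Moving to a coalition
      -- of the agent's own configuration requires a second copy, hence the cap at 2.
      (b = 0 ∨ (dig 3 g b ≠ 0 ∧ (b = a → dig 3 g b = 2))) → ¬ ConfDeviation γ σ mode a A b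

/-! ### The automaton -/

/-- Base for carry vectors. -/
def carryBase : ℕ := 3 * (numConf γ σ * (σ + 2)) + 2

/-- A state is the `Nat.pair` of a capped vector and a carry vector; the square comes from
`Nat.pair_lt_max_add_one_sq`, with the maximum replaced by a sum. -/
def stateBound : ℕ := (3 ^ numConf γ σ + carryBase γ σ ^ numRow γ σ) ^ 2

/-- Row `r` of the linear map applied to the digits of `y` in base `b`. -/
def rowSum (b y r : ℕ) : ℕ := ∑ a ∈ range (numConf γ σ), dig b y a * coef γ σ a r

def carry (x r : ℕ) : ℕ := dig (carryBase γ σ) x.unpair.2 r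

/-- The capped multiplicities are not read bit by bit: their whole contribution enters as the
initial carry. -/
def InitState (mode x : ℕ) : Prop :=
  StableCode γ σ mode x.unpair.1 ∧
    ∀ r < numRow γ σ, carry γ σ x r = rowSum γ σ 3 x.unpair.1 r

/-- Here `y` encodes one bit for each configuration and `m` one bit of the right-hand side for each
row. Kind rows must balance exactly; in the other two rows the inequality absorbs the slack, whose
digits need not be guessed. -/
def Transition (m x x' y : ℕ) : Prop :=
  x.unpair.1 = x'.unpair.1 ∧
  (∀ a < numConf γ σ, dig 2 y a ≠ 0 → dig 3 x.unpair.1 a = 2) ∧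
  ∀ r < numRow γ σ,
    rowSum γ σ 2 y r + carry γ σ x r ≤ dig 2 m r + 2 * carry γ σ x' r ∧
    (r < numKind γ σ → dig 2 m r + 2 * carry γ σ x' r ≤ rowSum γ σ 2 y r + carry γ σ x r)

/-- Sets of states are single numbers, so that the subset construction becomes a function on ℕ to
which primitive recursion applies. -/
noncomputable def initSet (mode : ℕ) : ℕ := bitset (InitState γ σ mode) (stateBound γ σ)

noncomputable def stepSet (S m : ℕ) : ℕ :=
  bitset (fun x' => ∃ x < stateBound γ σ, dig 2 S x = 1 ∧
    ∃ y < 2 ^ numConf γ σ, Transition γ σ m x x' y) (stateBound γ σ)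

def Accepting (S : ℕ) : Prop :=
  ∃ x < stateBound γ σ, dig 2 S x = 1 ∧ ∀ r < numRow γ σ, carry γ σ x r = 0

/-- The bits of level `t` of the right hand side `N`. -/
def levelMask (N : ℕ → ℕ) (t : ℕ) : ℕ := bits (fun r => N r / 2 ^ t % 2) 0 0 (numRow γ σ)

/-- The set of states reached after reading the `t` lowest levels. -/
noncomputable def reach (mode : ℕ) (N : ℕ → ℕ) : ℕ → ℕ
  | 0 => initSet γ σ mode
  | t + 1 => stepSet γ σ (reach mode N t) (levelMask γ σ N t)

/-- The integer program is solvable with capped multiplicities that are stable. -/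
def Solvable (mode : ℕ) (N : ℕ → ℕ) : Prop :=
  ∃ (g : ℕ) (y : ℕ → ℕ), StableCode γ σ mode g ∧
    (∀ a < numConf γ σ, y a ≠ 0 → dig 3 g a = 2) ∧
    ∀ r < numRow γ σ,
      ∑ a ∈ range (numConf γ σ), (dig 3 g a + y a) * coef γ σ a r ≤ N r ∧
      (r < numKind γ σ → N r ≤ ∑ a ∈ range (numConf γ σ), (dig 3 g a + y a) * coef γ σ a r)

end

/-! ### Correctness of the automaton -/

theorem dig_levelMask (γ σ : ℕ) (N : ℕ → ℕ) (t : ℕ) {r : ℕ} (hr : r < numRow γ σ) :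
    dig 2 (levelMask γ σ N t) r = N r / 2 ^ t % 2 := by
  rw [levelMask, bits_eq]
  simpa using dig_ofDig (b := 2) (f := fun i => N (0 + i) / 2 ^ t % 2)
    (fun i _ => Nat.mod_lt _ (by omega)) hr

theorem mod_two_pow_succ (x t : ℕ) : x % 2 ^ (t + 1) = x % 2 ^ t + 2 ^ t * (x / 2 ^ t % 2) := by
  rw [pow_succ, Nat.mod_mul]

/-- Multiplying the balance of level t by 2 ^ t and adding it to the invariant for t gives the
invariant for t + 1. A carry is thus what the rows still owe to the levels not yet read. -/
theorem reach_sound {γ σ mode : ℕ} {N : ℕ → ℕ} (t x : ℕ) (hx : x < stateBound γ σ)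
    (h : dig 2 (reach γ σ mode N t) x = 1) :
    StableCode γ σ mode x.unpair.1 ∧ ∃ y : ℕ → ℕ,
      (∀ a < numConf γ σ, y a ≠ 0 → dig 3 x.unpair.1 a = 2) ∧
      ∀ r < numRow γ σ,
        ∑ a ∈ range (numConf γ σ), (dig 3 x.unpair.1 a + y a) * coef γ σ a r
          ≤ N r % 2 ^ t + 2 ^ t * carry γ σ x r ∧
        (r < numKind γ σ → N r % 2 ^ t + 2 ^ t * carry γ σ x r ≤
          ∑ a ∈ range (numConf γ σ), (dig 3 x.unpair.1 a + y a) * coef γ σ a r) := by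
  induction t generalizing x with
  | zero =>
    rw [reach, initSet, dig_bitset hx] at h
    refine ⟨h.1, fun _ => 0, by simp, fun r hr => ?_⟩
    have := h.2 r hr
    simp [this, rowSum, Nat.mod_one]
  | succ t ih =>
    rw [reach, stepSet, dig_bitset hx] at h
    obtain ⟨w, hw, hwS, b, -, h1, h2, h3⟩ := h
    obtain ⟨i1, y, i2, i3⟩ := ih w hw hwS
    rw [h1] at i1 i2 i3 h2
    -- The guessed bits `b` of level t are put on top of the partial solution.
    refine ⟨i1, fun a => y a + 2 ^ t * dig 2 b a, fun a ha hne => ?_, fun r hr => ?_⟩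
    · by_cases hya : y a = 0
      · exact h2 a ha fun h0 => hne (by simp [hya, h0])
      · exact i2 a ha hya
    · obtain ⟨j1, j2⟩ := i3 r hr
      obtain ⟨k1, k2⟩ := h3 r hr
      rw [dig_levelMask _ _ _ _ hr] at k1 k2
      have e : ∑ a ∈ range (numConf γ σ),
            (dig 3 x.unpair.1 a + (y a + 2 ^ t * dig 2 b a)) * coef γ σ a r
          = ∑ a ∈ range (numConf γ σ), (dig 3 x.unpair.1 a + y a) * coef γ σ a r
            + 2 ^ t * rowSum γ σ 2 b r := by
        rw [rowSum, Finset.mul_sum, ← Finset.sum_add_distrib]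
        exact Finset.sum_congr rfl fun a _ => by ring
      rw [e, mod_two_pow_succ, pow_succ]
      constructor
      · have := Nat.mul_le_mul_left (2 ^ t) k1
        linarith
      · intro hrk
        have h4 := Nat.mul_le_mul_left (2 ^ t) (k2 hrk)
        have h5 := j2 hrk
        linarith

theorem coef_le (γ σ a r : ℕ) : coef γ σ a r ≤ σ + 1 := by
  unfold coef
  split_ifs
  · exact (dig_lt (by omega) _ _).le
  all_goals omega

theorem rowSum_three_le (γ σ y r : ℕ) : rowSum γ σ 3 y r ≤ 2 * (numConf γ σ * (σ + 2)) := by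
  have : ∀ a ∈ range (numConf γ σ), dig 3 y a * coef γ σ a r ≤ 2 * (σ + 2) := fun a _ =>
    Nat.mul_le_mul (by have := dig_lt (b := 3) (by omega) y a; omega)
      ((coef_le γ σ a r).trans (by omega))
  have := Finset.sum_le_card_nsmul _ _ _ this
  simp only [card_range, smul_eq_mul] at this
  rw [rowSum]; linarith

/-- A solution dictates its own run: cut `y` and the slack `s` down to their t lowest bits and take
the part of the row sum from level t upwards as the carry. The induction checks that consecutive
carries are joined by a transition. -/
theorem reach_complete {γ σ mode : ℕ} {N : ℕ → ℕ} {g : ℕ} {y s : ℕ → ℕ}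
    (hg : StableCode γ σ mode g) (hgb : g < 3 ^ numConf γ σ)
    (hy : ∀ a < numConf γ σ, y a ≠ 0 → dig 3 g a = 2)
    (hN : ∀ r < numRow γ σ,
      ∑ a ∈ range (numConf γ σ), (dig 3 g a + y a) * coef γ σ a r + s r = N r)
    (hs : ∀ r < numKind γ σ, s r = 0) (t : ℕ) :
    ∃ x < stateBound γ σ, x.unpair.1 = g ∧ dig 2 (reach γ σ mode N t) x = 1 ∧
      ∀ r < numRow γ σ, carry γ σ x r =
        (∑ a ∈ range (numConf γ σ), (dig 3 g a + y a % 2 ^ t) * coef γ σ a r + s r % 2 ^ t)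
          / 2 ^ t := by
  set X : ℕ → ℕ → ℕ := fun t r =>
    ∑ a ∈ range (numConf γ σ), (dig 3 g a + y a % 2 ^ t) * coef γ σ a r + s r % 2 ^ t with hX
  -- With K = `numConf γ σ`, the capped part contributes at most 2K(σ + 2), the truncated `y` at
  -- most 2 ^ t · K(σ + 2) and the slack less than 2 ^ t. After division by 2 ^ t this stays below
  -- 3K(σ + 2) + 2 for every t.
  have bound : ∀ t r, X t r / 2 ^ t < carryBase γ σ := fun t r => by
    rw [Nat.div_lt_iff_lt_mul (by positivity)]
    have h1 : ∑ a ∈ range (numConf γ σ), (y a % 2 ^ t) * coef γ σ a r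
        ≤ numConf γ σ * (2 ^ t * (σ + 2)) := by
      simpa using Finset.sum_le_card_nsmul (range (numConf γ σ))
        (fun a => (y a % 2 ^ t) * coef γ σ a r) (2 ^ t * (σ + 2)) fun a _ =>
        Nat.mul_le_mul (Nat.mod_lt _ (by positivity)).le ((coef_le γ σ a r).trans (by omega))
    have h2 := rowSum_three_le γ σ g r
    have h3 : X t r = rowSum γ σ 3 g r + ∑ a ∈ range (numConf γ σ), (y a % 2 ^ t) * coef γ σ a r
        + s r % 2 ^ t := by
      simp only [hX, rowSum, ← Finset.sum_add_distrib, add_mul]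
    have h4 : s r % 2 ^ t < 2 ^ t := Nat.mod_lt _ (by positivity)
    have h5 : 1 ≤ 2 ^ t := Nat.one_le_two_pow
    rw [h3, carryBase]
    have h6 := Nat.mul_le_mul h2 h5
    rw [mul_one] at h6
    nlinarith
  have hdig : ∀ t, ∃ c < carryBase γ σ ^ numRow γ σ, ∀ r < numRow γ σ,
      dig (carryBase γ σ) c r = X t r / 2 ^ t := fun t =>
    ⟨ofDig (carryBase γ σ) (fun r => X t r / 2 ^ t) (numRow γ σ),
      ofDig_lt fun r _ => bound t r, fun r hr => dig_ofDig (fun r _ => bound t r) hr⟩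
  have hpair : ∀ c < carryBase γ σ ^ numRow γ σ, Nat.pair g c < stateBound γ σ := fun c hc =>
    (Nat.pair_lt_max_add_one_sq g c).trans_le (Nat.pow_le_pow_left (by
      have := Nat.max_lt.2 ⟨hgb.trans_le (Nat.le_add_right _ (carryBase γ σ ^ numRow γ σ)),
        hc.trans_le (Nat.le_add_left _ (3 ^ numConf γ σ))⟩
      exact this) 2)
  induction t with
  | zero =>
    obtain ⟨c, hc, hcr⟩ := hdig 0
    refine ⟨Nat.pair g c, hpair c hc, by simp, ?_, fun r hr => by simp [carry, hcr r hr, hX]⟩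
    rw [reach, initSet, dig_bitset (hpair c hc)]
    refine ⟨by simpa using hg, fun r hr => ?_⟩
    simp [carry, hcr r hr, hX, rowSum, Nat.mod_one]
  | succ t ih =>
    obtain ⟨x, hx, hxg, hxS, hxc⟩ := ih
    obtain ⟨c, hc, hcr⟩ := hdig (t + 1)
    refine ⟨Nat.pair g c, hpair c hc, by simp, ?_, fun r hr => by simp [carry, hcr r hr, hX]⟩
    rw [reach, stepSet, dig_bitset (hpair c hc)]
    have hb1 : ∀ a < numConf γ σ, y a / 2 ^ t % 2 < 2 := fun a _ => Nat.mod_lt _ (by omega)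
    -- The guess at this level is the vector of t-th bits of `y`.
    refine ⟨x, hx, hxS, ofDig 2 (fun a => y a / 2 ^ t % 2) (numConf γ σ), ofDig_lt hb1,
      by simp [hxg], fun a ha h0 => ?_, fun r hr => ?_⟩
    · rw [dig_ofDig hb1 ha] at h0
      rw [hxg]
      exact hy a ha fun h => h0 (by simp [h])
    · have e1 : rowSum γ σ 2 (ofDig 2 (fun a => y a / 2 ^ t % 2) (numConf γ σ)) r
          = ∑ a ∈ range (numConf γ σ), (y a / 2 ^ t % 2) * coef γ σ a r :=
        Finset.sum_congr rfl fun a ha => by rw [dig_ofDig hb1 (by simpa using ha)]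
      have e2 : X (t + 1) r = X t r + 2 ^ t *
          (∑ a ∈ range (numConf γ σ), (y a / 2 ^ t % 2) * coef γ σ a r + s r / 2 ^ t % 2) := by
        have : ∑ a ∈ range (numConf γ σ), (dig 3 g a + y a % 2 ^ (t + 1)) * coef γ σ a r
            = ∑ a ∈ range (numConf γ σ), (dig 3 g a + y a % 2 ^ t) * coef γ σ a r
              + 2 ^ t * ∑ a ∈ range (numConf γ σ), (y a / 2 ^ t % 2) * coef γ σ a r := by
          rw [Finset.mul_sum, ← Finset.sum_add_distrib]
          exact Finset.sum_congr rfl fun a _ => by rw [mod_two_pow_succ]; ring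
        simp only [hX]
        rw [this, mod_two_pow_succ (s r)]
        ring
      have e3 : X (t + 1) r / 2 ^ t = X t r / 2 ^ t +
          (∑ a ∈ range (numConf γ σ), (y a / 2 ^ t % 2) * coef γ σ a r + s r / 2 ^ t % 2) := by
        rw [e2, Nat.add_mul_div_left _ _ (by positivity)]
      -- The bits of `y` and `s` from level t + 1 on contribute multiples of 2 ^ (t + 1). Hence bit
      -- t of `N r` is the parity of `X (t + 1) r / 2 ^ t`, and half of that number is the new
      -- carry.
      have e4 : N r % 2 ^ (t + 1) = X (t + 1) r % 2 ^ (t + 1) := by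
        have : Nat.ModEq (2 ^ (t + 1)) (N r) (X (t + 1) r) := by
          rw [← hN r hr]
          refine Nat.ModEq.add (Nat.ModEq.sum fun a _ => Nat.ModEq.mul_right _
            (Nat.ModEq.add_left _ (Nat.mod_modEq _ _).symm)) (Nat.mod_modEq _ _).symm
        exact this
      have e5 : N r / 2 ^ t % 2 = X (t + 1) r / 2 ^ t % 2 := by
        rw [← Nat.mod_mul_right_div_self (N r), ← Nat.mod_mul_right_div_self (X (t + 1) r),
          ← pow_succ, e4]
      have e6 : X (t + 1) r / 2 ^ (t + 1) = X (t + 1) r / 2 ^ t / 2 := by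
        rw [pow_succ, Nat.div_div_eq_div_mul]
      have e7 : carry γ σ (Nat.pair g c) r = X (t + 1) r / 2 ^ (t + 1) := by
        simp [carry, hcr r hr]
      have e8 := Nat.mod_add_div (X (t + 1) r / 2 ^ t) 2
      have e9 : carry γ σ x r = X t r / 2 ^ t := hxc r hr
      rw [e1, e9, e7, dig_levelMask _ _ _ _ hr, e5, e6, e8, e3]
      refine ⟨by omega, fun hrk => ?_⟩
      simp [hs r hrk, Nat.add_comm]

theorem accepting_reach_iff {γ σ mode : ℕ} {N : ℕ → ℕ} {t : ℕ}
    (hN : ∀ r < numRow γ σ, N r < 2 ^ t) :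
    Accepting γ σ (reach γ σ mode N t) ↔ Solvable γ σ mode N := by
  constructor
  · rintro ⟨x, hx, hxS, hc⟩
    obtain ⟨h1, y, h2, h3⟩ := reach_sound t x hx hxS
    refine ⟨_, y, h1, h2, fun r hr => ?_⟩
    simpa [hc r hr, Nat.mod_eq_of_lt (hN r hr)] using h3 r hr
  · rintro ⟨g₀, y, hg, hy, hsum⟩
    have hlt : ∀ a < numConf γ σ, dig 3 g₀ a < 3 := fun a _ => dig_lt (by omega) _ _
    -- Solvability puts no bound on the code, so digits beyond the configurations are cut off to
    -- obtain a state within range.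
    set g := ofDig 3 (dig 3 g₀) (numConf γ σ)
    have hdg : ∀ a < numConf γ σ, dig 3 g a = dig 3 g₀ a := fun a ha => dig_ofDig hlt ha
    have hg' : StableCode γ σ mode g := by
      intro a ha h0
      rw [hdg a ha] at h0
      refine ⟨(hg a ha h0).1, fun A hA hA0 b hb hb' => (hg a ha h0).2 A hA hA0 b hb ?_⟩
      rwa [hdg b hb] at hb'
    have esum : ∀ r, ∑ a ∈ range (numConf γ σ), (dig 3 g a + y a) * coef γ σ a r
        = ∑ a ∈ range (numConf γ σ), (dig 3 g₀ a + y a) * coef γ σ a r := fun r =>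
      Finset.sum_congr rfl fun a ha => by rw [hdg a (by simpa using ha)]
    set s : ℕ → ℕ := fun r =>
      N r - ∑ a ∈ range (numConf γ σ), (dig 3 g a + y a) * coef γ σ a r with hs
    obtain ⟨x, hx, -, hxS, hxc⟩ := reach_complete (N := N) (s := s) hg' (ofDig_lt hlt)
      (fun a ha h => by rw [hdg a ha]; exact hy a ha h)
      (fun r hr => by
        have := (hsum r hr).1
        rw [← esum] at this
        simp only [hs]; omega)
      (fun r hr => by
        have := (hsum r (by unfold numRow; omega)).2 hr
        rw [← esum] at this
        simp only [hs]; omega) t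
    refine ⟨x, hx, hxS, fun r hr => ?_⟩
    rw [hxc r hr]
    -- After t levels the truncated row sum with its slack is at most `N r < 2 ^ t`, so no carry
    -- remains.
    refine Nat.div_eq_of_lt (lt_of_le_of_lt ?_ (hN r hr))
    have h1 : ∑ a ∈ range (numConf γ σ), (dig 3 g a + y a % 2 ^ t) * coef γ σ a r
        ≤ ∑ a ∈ range (numConf γ σ), (dig 3 g a + y a) * coef γ σ a r :=
      Finset.sum_le_sum fun a _ => Nat.mul_le_mul_right _ (by
        have := Nat.mod_le (y a) (2 ^ t); omega)
    have h2 := Nat.mod_le (s r) (2 ^ t)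
    have h3 := (hsum r hr).1
    rw [← esum] at h3
    simp only [hs] at h2 ⊢
    omega

-- Primitive recursiveness of everything that depends on the parameter alone

attribute [fun_prop] Primrec

section Closure
variable {α β : Type*} [Primcodable α] [Primcodable β] {f g h : α → ℕ}

@[fun_prop] theorem primrec_id : Primrec fun a : α => a := Primrec.id
@[fun_prop] theorem primrec_const (b : β) : Primrec fun _ : α => b := Primrec.const b
@[fun_prop] theorem primrec_comp {γ : Type*} [Primcodable γ] {u : β → γ} {v : α → β}
    (hu : Primrec u) (hv : Primrec v) : Primrec fun a => u (v a) := hu.comp hv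
@[fun_prop] theorem primrec_fst {γ : Type*} [Primcodable γ] {u : α → β × γ} (hu : Primrec u) :
    Primrec fun a => (u a).1 := Primrec.fst.comp hu
@[fun_prop] theorem primrec_snd {γ : Type*} [Primcodable γ] {u : α → β × γ} (hu : Primrec u) :
    Primrec fun a => (u a).2 := Primrec.snd.comp hu
@[fun_prop] theorem primrec_mk {γ : Type*} [Primcodable γ] {u : α → β} {v : α → γ}
    (hu : Primrec u) (hv : Primrec v) : Primrec fun a => (u a, v a) := hu.pair hv
@[fun_prop] theorem primrec_add (hf : Primrec f) (hg : Primrec g) :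
    Primrec fun a => f a + g a := Primrec.nat_add.comp hf hg
@[fun_prop] theorem primrec_mul (hf : Primrec f) (hg : Primrec g) :
    Primrec fun a => f a * g a := Primrec.nat_mul.comp hf hg
@[fun_prop] theorem primrec_div (hf : Primrec f) (hg : Primrec g) :
    Primrec fun a => f a / g a := Primrec.nat_div.comp hf hg
@[fun_prop] theorem primrec_mod (hf : Primrec f) (hg : Primrec g) :
    Primrec fun a => f a % g a := Primrec.nat_mod.comp hf hg
@[fun_prop] theorem primrec_pow (hf : Primrec f) (hg : Primrec g) :
    Primrec fun a => f a ^ g a := (Primrec₂.unpaired'.1 Nat.Primrec.pow).comp hf hg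
@[fun_prop] theorem primrec_unpair (hf : Primrec f) :
    Primrec fun a => (f a).unpair := Primrec.unpair.comp hf
@[fun_prop] theorem primrec_sum {u : α → ℕ → ℕ} (hf : Primrec f)
    (hu : Primrec fun q : α × ℕ => u q.1 q.2) :
    Primrec fun a => ∑ i ∈ range (f a), u a i := by
  have h1 : Primrec₂ fun (a : α) (p : ℕ × ℕ) => p.2 + u a p.1 := by
    unfold Primrec₂
    have h2 : Primrec fun q : α × ℕ × ℕ => u q.1 q.2.1 :=
      hu.comp (Primrec.fst.pair (Primrec.fst.comp Primrec.snd))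
    fun_prop
  refine (Primrec.nat_rec' hf (Primrec.const 0) h1).of_eq fun a => ?_
  induction f a with
  | zero => rfl
  | succ n ih => simp only [Finset.sum_range_succ, ← ih]

theorem primrec_ite {p : α → Prop} [DecidablePred p] (hp : PrimrecPred p) (hf : Primrec f)
    (hg : Primrec g) : Primrec fun a => if p a then f a else g a := Primrec.ite hp hf hg

theorem primrecPred_imp {p q : α → Prop} (hp : PrimrecPred p) (hq : PrimrecPred q) :
    PrimrecPred fun a => p a → q a := (hp.not.or hq).of_eq fun a => by tauto

theorem primrecPred_exists_lt {p : α → ℕ → Prop} (hf : Primrec f)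
    (hp : PrimrecPred fun q : α × ℕ => p q.1 q.2) : PrimrecPred fun a => ∃ x < f a, p a x := by
  have : PrimrecRel fun (x : ℕ) (a : α) => p a x := hp.comp (Primrec.snd.pair Primrec.fst)
  exact (this.exists_mem_list.comp (Primrec.list_range.comp hf) Primrec.id).of_eq (by simp)

theorem primrecPred_forall_lt {p : α → ℕ → Prop} (hf : Primrec f)
    (hp : PrimrecPred fun q : α × ℕ => p q.1 q.2) : PrimrecPred fun a => ∀ x < f a, p a x := by
  have : PrimrecRel fun (x : ℕ) (a : α) => p a x := hp.comp (Primrec.snd.pair Primrec.fst)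
  exact (this.forall_mem_list.comp (Primrec.list_range.comp hf) Primrec.id).of_eq (by simp)

theorem primrecPred_eq (hf : Primrec f) (hg : Primrec g) : PrimrecPred fun a => f a = g a :=
  Primrec.eq.comp hf hg
theorem primrecPred_lt (hf : Primrec f) (hg : Primrec g) : PrimrecPred fun a => f a < g a :=
  Primrec.nat_lt.comp hf hg
theorem primrecPred_le (hf : Primrec f) (hg : Primrec g) : PrimrecPred fun a => f a ≤ g a :=
  Primrec.nat_le.comp hf hg

@[fun_prop] theorem primrec_dig (hf : Primrec f) (hg : Primrec g) (hh : Primrec h) :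
    Primrec fun a => dig (f a) (g a) (h a) := by unfold dig; fun_prop

@[fun_prop] theorem primrec_bitset {p : α → ℕ → Prop} (hf : Primrec f)
    (hp : PrimrecPred fun q : α × ℕ => p q.1 q.2) : Primrec fun a => bitset (p a) (f a) := by
  classical
  unfold bitset ofDig
  have := primrec_ite (f := fun _ => 1) (g := fun _ => 0) hp (by fun_prop) (by fun_prop)
  fun_prop

end Closure

section Parameters
variable {α : Type*} [Primcodable α] {γ σ m x y a b A B v w r S : α → ℕ}

@[fun_prop] theorem primrec_numProf (hγ : Primrec γ) (hσ : Primrec σ) :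
    Primrec fun q => numProf (γ q) (σ q) := by unfold numProf; fun_prop
@[fun_prop] theorem primrec_numKind (hγ : Primrec γ) (hσ : Primrec σ) :
    Primrec fun q => numKind (γ q) (σ q) := by unfold numKind; fun_prop
@[fun_prop] theorem primrec_numRow (hγ : Primrec γ) (hσ : Primrec σ) :
    Primrec fun q => numRow (γ q) (σ q) := by unfold numRow; fun_prop
@[fun_prop] theorem primrec_numConf (hγ : Primrec γ) (hσ : Primrec σ) :
    Primrec fun q => numConf (γ q) (σ q) := by unfold numConf; fun_prop
@[fun_prop] theorem primrec_kindColor (hγ : Primrec γ) (hσ : Primrec σ) (hA : Primrec A) :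
    Primrec fun q => kindColor (γ q) (σ q) (A q) := by unfold kindColor; fun_prop
@[fun_prop] theorem primrec_confSize (hγ : Primrec γ) (hσ : Primrec σ) (ha : Primrec a) :
    Primrec fun q => confSize (γ q) (σ q) (a q) := by unfold confSize; fun_prop
@[fun_prop] theorem primrec_confProf (hγ : Primrec γ) (hσ : Primrec σ) (ha : Primrec a) :
    Primrec fun q => confProf (γ q) (σ q) (a q) := by unfold confProf; fun_prop
@[fun_prop] theorem primrec_coef (hγ : Primrec γ) (hσ : Primrec σ) (ha : Primrec a)
    (hr : Primrec r) : Primrec fun q => coef (γ q) (σ q) (a q) (r q) := by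
  unfold coef
  refine primrec_ite (primrecPred_lt ?_ ?_) ?_ (primrec_ite (primrecPred_eq ?_ ?_) ?_
    (primrec_ite (primrecPred_eq ?_ ?_) ?_ ?_)) <;> fun_prop
@[fun_prop] theorem primrec_rowSum (hγ : Primrec γ) (hσ : Primrec σ) (hb : Primrec b)
    (hy : Primrec y) (hr : Primrec r) :
    Primrec fun q => rowSum (γ q) (σ q) (b q) (y q) (r q) := by unfold rowSum; fun_prop
@[fun_prop] theorem primrec_carryBase (hγ : Primrec γ) (hσ : Primrec σ) :
    Primrec fun q => carryBase (γ q) (σ q) := by unfold carryBase; fun_prop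
@[fun_prop] theorem primrec_stateBound (hγ : Primrec γ) (hσ : Primrec σ) :
    Primrec fun q => stateBound (γ q) (σ q) := by unfold stateBound; fun_prop
@[fun_prop] theorem primrec_carry (hγ : Primrec γ) (hσ : Primrec σ) (hx : Primrec x)
    (hr : Primrec r) : Primrec fun q => carry (γ q) (σ q) (x q) (r q) := by
  unfold carry; fun_prop

theorem primrecPred_kindStrict (hγ : Primrec γ) (hσ : Primrec σ) (hA : Primrec A)
    (hv : Primrec v) (hw : Primrec w) :
    PrimrecPred fun q => KindStrict (γ q) (σ q) (A q) (v q) (w q) := by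
  unfold KindStrict
  refine (primrecPred_eq ?_ ?_).and (primrecPred_eq ?_ ?_).not <;> fun_prop

theorem primrecPred_confDeviation (mode : ℕ) (hγ : Primrec γ) (hσ : Primrec σ) (ha : Primrec a)
    (hA : Primrec A) (hb : Primrec b) :
    PrimrecPred fun q => ConfDeviation (γ q) (σ q) mode (a q) (A q) (b q) := by
  unfold ConfDeviation
  refine (primrecPred_kindStrict hγ hσ hA ?_ ?_).and ((primrecPred_eq ?_ ?_).or
    (primrecPred_forall_lt ?_ (primrecPred_imp (primrecPred_eq ?_ ?_).not
      (primrecPred_eq ?_ ?_)))) <;> fun_prop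

theorem primrecPred_stableCode (mode : ℕ) (hγ : Primrec γ) (hσ : Primrec σ) (hx : Primrec x) :
    PrimrecPred fun q => StableCode (γ q) (σ q) mode (x q) := by
  unfold StableCode
  refine primrecPred_forall_lt ?_ (primrecPred_imp (primrecPred_eq ?_ ?_).not
    (((primrecPred_eq ?_ ?_).not.and (primrecPred_le ?_ ?_)).and
    (primrecPred_forall_lt ?_ (primrecPred_imp (primrecPred_eq ?_ ?_).not
    (primrecPred_forall_lt ?_ (primrecPred_imp ((primrecPred_eq ?_ ?_).or
      ((primrecPred_eq ?_ ?_).not.and (primrecPred_imp (primrecPred_eq ?_ ?_)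
      (primrecPred_eq ?_ ?_))))
      (primrecPred_confDeviation mode ?_ ?_ ?_ ?_ ?_).not)))))) <;> fun_prop

theorem primrec_initSet (mode : ℕ) (hγ : Primrec γ) (hσ : Primrec σ) :
    Primrec fun q => initSet (γ q) (σ q) mode := by
  unfold initSet InitState
  refine primrec_bitset ?_ ((primrecPred_stableCode mode ?_ ?_ ?_).and
    (primrecPred_forall_lt ?_ (primrecPred_eq ?_ ?_))) <;> fun_prop

theorem primrec_stepSet (hγ : Primrec γ) (hσ : Primrec σ) (hS : Primrec S) (hm : Primrec m) :
    Primrec fun q => stepSet (γ q) (σ q) (S q) (m q) := by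
  unfold stepSet Transition
  refine primrec_bitset ?_ (primrecPred_exists_lt ?_ ((primrecPred_eq ?_ ?_).and
    (primrecPred_exists_lt ?_ ((primrecPred_eq ?_ ?_).and ((primrecPred_forall_lt ?_
    (primrecPred_imp (primrecPred_eq ?_ ?_).not (primrecPred_eq ?_ ?_))).and
    (primrecPred_forall_lt ?_ ((primrecPred_le ?_ ?_).and
    (primrecPred_imp (primrecPred_lt ?_ ?_) (primrecPred_le ?_ ?_))))))))) <;> fun_prop

open Classical in
theorem primrec_accepting (hγ : Primrec γ) (hσ : Primrec σ) (hS : Primrec S) :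
    Primrec fun q => if Accepting (γ q) (σ q) (S q) then 1 else 0 := by
  refine primrec_ite (f := fun _ => 1) (g := fun _ => 0) ?_ (by fun_prop) (by fun_prop)
  unfold Accepting
  refine primrecPred_exists_lt ?_ ((primrecPred_eq ?_ ?_).and
    (primrecPred_forall_lt ?_ (primrecPred_eq ?_ ?_))) <;> fun_prop

/-- Whether the agent with color `c` and (capped) rank `a` represents profile `v`. -/
def repTest (σ v c a : ℕ) : ℕ := if a < dig (σ + 2) v c then 1 else 0

theorem primrec_repTest (hσ : Primrec σ) (hv : Primrec v) (hb : Primrec b) (ha : Primrec a) :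
    Primrec fun q => repTest (σ q) (v q) (b q) (a q) := by
  unfold repTest
  refine primrec_ite (f := fun _ => 1) (g := fun _ => 0) (primrecPred_lt ?_ ?_) ?_ ?_ <;> fun_prop

end Parameters

/-! ### Timed correctness statements -/

/-- Started in `s`, program `p` halts within `T` time units in a memory satisfying `Q`. -/
def Runs (O : ℕ → List ℕ → List ℕ → ℕ) (p : Program) (s : Memory) (T : ℕ)
    (Q : Memory → Prop) : Prop := ∃ t s', Exec O p s t s' ∧ t ≤ T ∧ Q s'

theorem Memory.set_apply (s : Memory) (A j v B i : ℕ) :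
    s.set A j v B i = if B = A ∧ i = j then v else s B i := by
  unfold Memory.set
  by_cases h : B = A
  · subst h
    by_cases h2 : i = j
    · simp [h2]
    · simp [h2]
  · simp [h]

theorem Memory.set_of_ne (s : Memory) {A B : ℕ} (j v : ℕ) (h : B ≠ A) : s.set A j v B = s B := by
  simp [Memory.set, h]

section
variable {O : ℕ → List ℕ → List ℕ → ℕ} {p q : Program} {s : Memory} {T T' : ℕ}
  {Q R : Memory → Prop} {e : Expr}

theorem Runs.mono (h : Runs O p s T Q) (hT : T ≤ T') (hQ : ∀ s', Q s' → R s') :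
    Runs O p s T' R := by
  obtain ⟨t, s', h1, h2, h3⟩ := h
  exact ⟨t, s', h1, h2.trans hT, hQ _ h3⟩

theorem Runs.skip (h : Q s) : Runs O .skip s 1 Q := ⟨1, s, .skip s, le_rfl, h⟩

theorem Runs.write {A : ℕ} {idx val : Expr} (h : Q (s.set A (idx.eval s) (val.eval s))) :
    Runs O (.write A idx val) s (idx.cost + val.cost + 1) Q := ⟨_, _, .write A idx val s, le_rfl, h⟩

theorem Runs.query {A : ℕ} {idx agent : Expr} {C D : Segment}
    (h : Q (s.set A (idx.eval s) (O (agent.eval s) (C.eval s) (D.eval s)))) :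
    Runs O (.query A idx agent C D) s (idx.cost + agent.cost + C.cost + D.cost + 1) Q :=
  ⟨_, _, .query A idx agent C D s, le_rfl, h⟩

theorem Runs.seq (h : Runs O p s T Q) (h' : ∀ s', Q s' → Runs O q s' T' R) :
    Runs O (.seq p q) s (T + T') R := by
  obtain ⟨t, s', h1, h2, h3⟩ := h
  obtain ⟨t', s'', h1', h2', h3'⟩ := h' s' h3
  exact ⟨_, s'', .seq h1 h1', add_le_add h2 h2', h3'⟩

theorem Runs.ite (h1 : e.eval s ≠ 0 → Runs O p s T Q) (h2 : e.eval s = 0 → Runs O q s T Q) :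
    Runs O (.ite e p q) s (e.cost + 1 + T) Q := by
  by_cases h : e.eval s = 0
  · obtain ⟨t, s', a, b, c⟩ := h2 h
    exact ⟨_, s', .ite_false h a, by omega, c⟩
  · obtain ⟨t, s', a, b, c⟩ := h1 h
    exact ⟨_, s', .ite_true h a, by omega, c⟩

end

/-- The scalar variable `A`, kept in cell `0` of array `A`. -/
def var (A : ℕ) : Expr := .read A (.const 0)

def assign (A : ℕ) (e : Expr) : Program := .write A (.const 0) e

@[simp] theorem eval_var (s : Memory) (A : ℕ) : (var A).eval s = s A 0 := rfl
@[simp] theorem cost_var (A : ℕ) : (var A).cost = 2 := rfl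
attribute [simp] Expr.eval Expr.cost

theorem Runs.assign {O : ℕ → List ℕ → List ℕ → ℕ} {s : Memory} {Q : Memory → Prop} {A : ℕ}
    {e : Expr} (h : Q (s.set A 0 (e.eval s))) : Runs O (assign A e) s (e.cost + 2) Q :=
  (Runs.write (idx := .const 0) h).mono (by simp; omega) fun _ h => h

/-- Run `body` with variable `x` taking the values `e - 1, …, 0`. -/
def forDown (x : ℕ) (e : Expr) (body : Program) : Program :=
  .seq (assign x e) (.loop (var x) (.seq (assign x (.sub (var x) (.const 1))) body))

theorem Runs.forDown {O : ℕ → List ℕ → List ℕ → ℕ} {x : ℕ} {e : Expr} {body : Program}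
    {s : Memory} {T : ℕ} (J : ℕ → Memory → Prop) {N : ℕ} (hN : e.eval s = N)
    (hset : ∀ m ≤ N, ∀ s v, J m s → J m (s.set x 0 v)) (h0 : J N s)
    (hbody : ∀ m < N, ∀ s, J (m + 1) s → s x 0 = m →
      Runs O body s T fun s' => s' x 0 = m ∧ J m s') :
    Runs O (forDown x e body) s (e.cost + 5 + N * (T + 9)) (J 0) := by
  have key : ∀ m ≤ N, ∀ s, J m s → s x 0 = m →
      Runs O (.loop (var x) (.seq (HDG.assign x (.sub (var x) (.const 1))) body)) s
        (3 + m * (T + 9)) (J 0) := by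
    intro m
    induction m with
    | zero => exact fun _ s hJ hx => ⟨_, s, .loop_done (by simp [hx]), by simp, hJ⟩
    | succ m ih =>
      intro hm s hJ hx
      have h1 : Runs O (.seq (HDG.assign x (.sub (var x) (.const 1))) body) s (6 + T)
          fun s' => s' x 0 = m ∧ J m s' := by
        refine Runs.seq (Runs.assign (Q := fun s' => s' x 0 = m ∧ J (m + 1) s') ?_) ?_
        · exact ⟨by simp [Memory.set_apply, hx], hset _ hm _ _ hJ⟩
        · exact fun s' h => hbody m (by omega) s' h.2 h.1
      obtain ⟨t, s', a, b, c1, c2⟩ := h1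
      obtain ⟨t', s'', a', b', c'⟩ := ih (by omega) s' c2 c1
      exact ⟨_, s'', .loop_step (by simp [hx]) a a', by simp; linarith, c'⟩
  have := Runs.seq (Runs.assign (O := O) (A := x) (e := e) (s := s)
    (Q := fun s' => J N s' ∧ s' x 0 = N) ⟨hset _ le_rfl _ _ h0, by simp [Memory.set_apply, hN]⟩)
    fun s' h => key N le_rfl s' h.1 h.2
  exact this.mono (by omega) fun _ h => h

/-! ### Primitive recursive functions are computed by programs -/

/-- `p` computes `f` of the variables `r`, putting the result into variable `base` and changing no
array before `base`; as long as the arguments are at most `b`, it runs in time `T b`. -/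
def Computes {m : ℕ} (p : Program) (f : List.Vector ℕ m → ℕ) (r : Fin m → ℕ) (base : ℕ)
    (T : ℕ → ℕ) : Prop :=
  ∀ O s b, (∀ i, s (r i) 0 ≤ b) → Runs O p s (T b) fun s' =>
    s' base 0 = f (List.Vector.ofFn fun i => s (r i) 0) ∧ ∀ A < base, s' A = s A

/-- `f` has a program that runs in primitive recursive time; the time bound also bounds the value
of `f`. -/
def Compilable {m : ℕ} (f : List.Vector ℕ m → ℕ) : Prop :=
  ∃ T : ℕ → ℕ, Primrec T ∧ Monotone T ∧ (∀ v b, (∀ i, v.get i ≤ b) → f v ≤ T b) ∧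
    ∀ (r : Fin m → ℕ) (base : ℕ), (∀ i, r i < base) → ∃ p, Computes p f r base T

theorem primrec_sum_fin {n : ℕ} {T : Fin n → ℕ → ℕ} (h : ∀ i, Primrec (T i)) :
    Primrec fun b => ∑ i, T i b := by
  induction n with
  | zero => simpa using primrec_const 0
  | succ n ih =>
    simp only [Fin.sum_univ_succ]
    have h1 := h 0
    have h2 := ih fun i => h i.succ
    fun_prop

theorem compilable_zero : Compilable (m := 0) fun _ => 0 := by
  refine ⟨fun b => b + 3, by fun_prop, fun a b h => by simpa using h, fun v b _ => by simp,
    fun r base _ => ⟨assign base (.const 0), fun O s b _ => ?_⟩⟩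
  refine (Runs.assign (Q := fun s' => s' base 0 = 0 ∧ ∀ A < base, s' A = s A) ?_).mono
    (by simp) fun _ h => h
  exact ⟨by simp [Memory.set_apply], fun A hA => Memory.set_of_ne _ _ _ hA.ne⟩

theorem compilable_succ : Compilable (m := 1) fun v => Nat.succ v.head := by
  refine ⟨fun b => b + 7, by fun_prop, fun a b h => by simpa using h, fun v b h => ?_,
    fun r base _ => ⟨assign base (.add (var (r 0)) (.const 1)), fun O s b _ => ?_⟩⟩
  · have := h 0
    rw [List.Vector.get_zero] at this
    dsimp only
    omega
  · refine (Runs.assign (Q := fun s' => s' base 0 = _ ∧ ∀ A < base, s' A = s A) ?_).mono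
      (by simp) fun _ h => h
    exact ⟨by simp [Memory.set_apply], fun A hA => Memory.set_of_ne _ _ _ hA.ne⟩

theorem compilable_get {n : ℕ} (i : Fin n) : Compilable fun v => v.get i := by
  refine ⟨fun b => b + 7, by fun_prop, fun a b h => by simpa using h,
    fun v b h => (h i).trans (by simp),
    fun r base _ => ⟨assign base (var (r i)), fun O s b _ => ?_⟩⟩
  refine (Runs.assign (Q := fun s' => s' base 0 = _ ∧ ∀ A < base, s' A = s A) ?_).mono
    (by simp) fun _ h => h
  exact ⟨by simp [Memory.set_apply], fun A hA => Memory.set_of_ne _ _ _ hA.ne⟩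

/-- Programs for several functions of the same arguments can be run one after the other. -/
theorem compute_all {m n : ℕ} {g : Fin n → List.Vector ℕ m → ℕ} {T : Fin n → ℕ → ℕ}
    (r : Fin m → ℕ) (base : ℕ) (hr : ∀ i, r i < base)
    (h : ∀ i, ∀ base, (∀ j, r j < base) → ∃ p, Computes p (g i) r base (T i)) :
    ∃ p, ∀ O s b, (∀ i, s (r i) 0 ≤ b) → Runs O p s ((∑ i, T i b) + 1) fun s' =>
      (∀ i : Fin n, s' (base + i) 0 = g i (List.Vector.ofFn fun i => s (r i) 0)) ∧
        ∀ A < base, s' A = s A := by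
  induction n generalizing base with
  | zero => exact ⟨.skip, fun O s b _ => by simpa using Runs.skip (fun _ _ => rfl)⟩
  | succ n ih =>
    obtain ⟨p, hp⟩ := h 0 base hr
    obtain ⟨q, hq⟩ := ih (g := fun i => g i.succ) (T := fun i => T i.succ) (base + 1)
      (fun i => (hr i).trans (by omega)) fun i => h i.succ
    refine ⟨.seq p q, fun O s b hb => ?_⟩
    refine ((hp O s b hb).seq fun s' hs' => (hq O s' b fun i => ?_).mono le_rfl
      (R := fun s'' => (∀ i : Fin (n + 1), s'' (base + i) 0 =
        g i (List.Vector.ofFn fun i => s (r i) 0)) ∧ ∀ A < base, s'' A = s A)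
      fun s'' hs'' => ?_).mono (by rw [Fin.sum_univ_succ]; omega) fun _ h => h
    · rw [hs'.2 _ (hr i)]; exact hb i
    · refine ⟨fun i => ?_, fun A hA => by rw [hs''.2 A (by omega), hs'.2 A hA]⟩
      refine Fin.cases ?_ (fun i => ?_) i
      · rw [Fin.val_zero, add_zero, hs''.2 base (by omega), hs'.1]
      · have := hs''.1 i
        rw [Fin.val_succ, show base + (i + 1 : ℕ) = base + 1 + i by omega, this]
        congr 2
        funext j
        rw [hs'.2 _ (hr j)]

/-- Since time bounds also bound values, the sum of the inner bounds is a legitimate argument bound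
for the outer program. -/
theorem compilable_comp {m n : ℕ} {f : List.Vector ℕ n → ℕ} {g : Fin n → List.Vector ℕ m → ℕ}
    (hf : Compilable f) (hg : ∀ i, Compilable (g i)) :
    Compilable fun a => f (List.Vector.ofFn fun i => g i a) := by
  obtain ⟨Tf, pf, mf, vf, cf⟩ := hf
  choose T hT hm hv hc using hg
  have hsum := primrec_sum_fin hT
  have hle : ∀ i b, T i b ≤ ∑ i, T i b := fun i b =>
    Finset.single_le_sum (f := fun i => T i b) (fun _ _ => Nat.zero_le _) (Finset.mem_univ i)
  refine ⟨fun b => (∑ i, T i b) + Tf (∑ i, T i b) + 5, by fun_prop, fun a b h => ?_,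
    fun v b h => ?_, fun r base hr => ?_⟩
  · have h1 : ∑ i, T i a ≤ ∑ i, T i b := Finset.sum_le_sum fun i _ => hm i h
    have h2 := mf h1
    dsimp only
    omega
  · refine (vf _ (∑ i, T i b) fun i => ?_).trans (by dsimp only; omega)
    simpa using (hv i v b h).trans (hle i b)
  · obtain ⟨p, hp⟩ := compute_all (g := g) r (base + 1) (fun i => (hr i).trans (by omega))
      fun i base hb => hc i r base hb
    obtain ⟨q, hq⟩ := cf (fun i => base + 1 + i) (base + 1 + n) fun i => by have := i.2; omega
    refine ⟨.seq p (.seq q (assign base (var (base + 1 + n)))), fun O s b hb => ?_⟩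
    refine ((hp O s b hb).seq fun s' hs' => ((hq O s' (∑ i, T i b) fun i => ?_).seq
      (R := fun s' => s' base 0 = _ ∧ ∀ A < base, s' A = s A)
      fun s'' hs'' => Runs.assign ?_)).mono (by simp; omega) fun _ h => h
    · rw [hs'.1 i]
      exact (hv i _ b (by simpa using hb)).trans (hle i b)
    · refine ⟨?_, fun A hA => ?_⟩
      · simp [Memory.set_apply, hs''.1, hs'.1]
      · rw [Memory.set_of_ne _ _ _ hA.ne, hs''.2 A (by omega), hs'.2 A (by omega)]

/-- A common bound of the values that occur in a primitive recursion. -/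
def recBound (Tf Tg : ℕ → ℕ) (b : ℕ) : ℕ → ℕ
  | 0 => b + Tf b
  | n + 1 => recBound Tf Tg b n + Tg (recBound Tf Tg b n)

theorem recBound_mono_right (Tf Tg : ℕ → ℕ) (b : ℕ) : Monotone (recBound Tf Tg b) :=
  monotone_nat_of_le_succ fun n => by simp [recBound]

theorem recBound_mono_left {Tf Tg : ℕ → ℕ} (hf : Monotone Tf) (hg : Monotone Tg) {b b' : ℕ}
    (h : b ≤ b') (n : ℕ) : recBound Tf Tg b n ≤ recBound Tf Tg b' n := by
  induction n with
  | zero => exact add_le_add h (hf h)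
  | succ n ih => exact add_le_add ih (hg ih)

theorem primrec_recBound {Tf Tg : ℕ → ℕ} (hf : Primrec Tf) (hg : Primrec Tg) :
    Primrec fun b => recBound Tf Tg b b := by
  have h1 : Primrec fun b => b + Tf b := by fun_prop
  have h2 : Primrec₂ fun (_ : ℕ) (q : ℕ × ℕ) => q.2 + Tg q.2 := by
    unfold Primrec₂; fun_prop
  refine (Primrec.nat_rec' Primrec.id h1 h2).of_eq fun b => ?_
  have : ∀ n, Nat.rec (b + Tf b) (fun _ v => v + Tg v) n = recBound Tf Tg b n := fun n => by
    induction n with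
    | zero => rfl
    | succ n ih => simp only [recBound, ← ih]
  exact this b

theorem vector_cons_ofFn_le {n : ℕ} {v : List.Vector ℕ n} {a b B : ℕ} (ha : a ≤ B) (hb : b ≤ B)
    (hv : ∀ i, v.get i ≤ B) (i : Fin (n + 2)) : (a ::ᵥ b ::ᵥ v).get i ≤ B := by
  refine Fin.cases (by simpa) (fun i => ?_) i
  refine Fin.cases (by simpa) (fun i => ?_) i
  simpa using hv i

theorem rec_le_recBound {n : ℕ} {f : List.Vector ℕ n → ℕ} {g : List.Vector ℕ (n + 2) → ℕ}
    {Tf Tg : ℕ → ℕ} (vf : ∀ v b, (∀ i, v.get i ≤ b) → f v ≤ Tf b)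
    (vg : ∀ v b, (∀ i, v.get i ≤ b) → g v ≤ Tg b) {v : List.Vector ℕ n} {b : ℕ}
    (hv : ∀ i, v.get i ≤ b) : ∀ y ≤ b,
      (Nat.rec (f v) (fun y IH => g (y ::ᵥ IH ::ᵥ v)) y : ℕ) ≤ recBound Tf Tg b y
  | 0, _ => (vf v b hv).trans (by simp [recBound])
  | y + 1, hy => by
    have ih := rec_le_recBound vf vg hv y (by omega)
    have hb : b ≤ recBound Tf Tg b y :=
      (Nat.le_add_right _ _).trans (recBound_mono_right Tf Tg b (Nat.zero_le y))
    exact (vg _ _ (vector_cons_ofFn_le ((by omega : y ≤ b).trans hb) ih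
      fun i => (hv i).trans hb)).trans (by simp [recBound])

/-- All values met during the recursion stay below `recBound Tf Tg b b`, so each round is charged
the same time, and this bound is itself primitive recursive in b. -/
theorem compilable_prec {n : ℕ} {f : List.Vector ℕ n → ℕ} {g : List.Vector ℕ (n + 2) → ℕ}
    (hf : Compilable f) (hg : Compilable g) :
    Compilable fun v : List.Vector ℕ (n + 1) =>
      v.head.rec (f v.tail) fun y IH => g (y ::ᵥ IH ::ᵥ v.tail) := by
  obtain ⟨Tf, pf, mf, vf, cf⟩ := hf
  obtain ⟨Tg, pg, mg, vg, cg⟩ := hg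
  have hW := primrec_recBound pf pg
  have hWm : Monotone fun b => recBound Tf Tg b b := fun a b h =>
    (recBound_mono_left mf mg h a).trans (recBound_mono_right _ _ _ h)
  refine ⟨fun b => recBound Tf Tg b b + Tf b + b * (Tg (recBound Tf Tg b b) + 20) + 20,
    by fun_prop, fun a b h => ?_, fun v b h => ?_, fun r base hr => ?_⟩
  · have h1 := hWm h
    have h2 := mf h
    have h3 := Nat.mul_le_mul h (add_le_add_left (mg h1) 20)
    dsimp only at h1 h3 ⊢
    omega
  · have h0 : v.head ≤ b := by simpa using h 0
    refine (rec_le_recBound vf vg (fun i => ?_) v.head h0).trans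
      ((recBound_mono_right Tf Tg b h0).trans (by dsimp only; omega))
    simpa using h i.succ
  · obtain ⟨p, hp⟩ := cf (fun i => r i.succ) (base + 3) fun i => (hr _).trans (by omega)
    obtain ⟨q, hq⟩ := cg (Fin.cons (base + 1) (Fin.cons base fun i => r i.succ)) (base + 3)
      fun i => by
        refine Fin.cases (by simp) (fun i => ?_) i
        refine Fin.cases (by simp) (fun i => ?_) i
        simpa using (hr _).trans (by omega)
    -- `base` holds the accumulator, `base + 1` the ascending recursion index and `base + 2` the
    -- descending loop counter; the subprograms work from `base + 3` on.
    refine ⟨.seq p (.seq (assign base (var (base + 3))) (.seq (assign (base + 1) (.const 0))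
      (forDown (base + 2) (var (r 0)) (.seq q (.seq (assign base (var (base + 3)))
        (assign (base + 1) (.add (var (base + 1)) (.const 1)))))))), fun O s b hb => ?_⟩
    set v := List.Vector.ofFn fun i => s (r i) 0 with hv
    set W := recBound Tf Tg b b
    have hvt : ∀ i, v.tail.get i ≤ b := fun i => by simpa [hv] using hb i.succ
    have hvh : v.head = s (r 0) 0 := by simp [hv]
    set F : ℕ → ℕ := fun y => Nat.rec (f v.tail) (fun y IH => g (y ::ᵥ IH ::ᵥ v.tail)) y with hF
    have hFW : ∀ y ≤ b, F y ≤ W := fun y hy =>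
      (rec_le_recBound vf vg hvt y hy).trans (recBound_mono_right _ _ _ hy)
    have hbW : b ≤ W := (Nat.le_add_right _ _).trans (recBound_mono_right Tf Tg b (Nat.zero_le b))
    have htail : (List.Vector.ofFn fun i : Fin n => s (r i.succ) 0) = v.tail :=
      List.Vector.ext fun i => by simp [hv]
    set N := s (r 0) 0 with hN
    have hNb : N ≤ b := hb 0
    set J : ℕ → Memory → Prop := fun m s' =>
      s' base 0 = F (N - m) ∧ s' (base + 1) 0 = N - m ∧ ∀ A < base, s' A = s A with hJ
    refine ((hp O s b fun i => hb _).seq (R := fun s' => s' base 0 = F v.head ∧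
      ∀ A < base, s' A = s A) fun s1 hs1 => (Runs.assign (Q := fun s' => s' base 0 = f v.tail ∧
        ∀ A < base, s' A = s A) ?_).seq fun s2 hs2 => (Runs.assign (Q := J N) ?_).seq
        fun s3 hs3 => (Runs.forDown (T := Tg W + 11) J ?_ ?_ hs3 ?_).mono le_rfl
        fun s4 hs4 => ?_).mono ?_ fun _ h => h
    · refine ⟨?_, fun A hA => ?_⟩
      · simp [Memory.set_apply, hs1.1, htail]
      · rw [Memory.set_of_ne _ _ _ hA.ne, hs1.2 A (by omega)]
    · refine ⟨?_, ?_, fun A hA => ?_⟩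
      · simp [Memory.set_apply, hs2.1, hF]
      · simp [Memory.set_apply]
      · rw [Memory.set_of_ne _ _ _ (by omega), hs2.2 A hA]
    · simp [hs3.2.2 _ (hr 0), hN]
    · rintro m - s' w ⟨h1, h2, h3⟩
      refine ⟨?_, ?_, fun A hA => ?_⟩
      · rw [Memory.set_of_ne _ _ _ (by omega), h1]
      · rw [Memory.set_of_ne _ _ _ (by omega), h2]
      · rw [Memory.set_of_ne _ _ _ (by omega), h3 A hA]
    · rintro m hm s' ⟨h1, h2, h3⟩ hx
      have hargs : (List.Vector.ofFn fun i : Fin (n + 2) => s' ((Fin.cons (base + 1)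
          (Fin.cons base fun i => r i.succ) : Fin (n + 2) → ℕ) i) 0)
          = (N - (m + 1)) ::ᵥ F (N - (m + 1)) ::ᵥ v.tail := by
        refine List.Vector.ext fun i => ?_
        refine Fin.cases ?_ (fun i => ?_) i
        · simp [h2]
        refine Fin.cases ?_ (fun i => ?_) i
        · have hc : ∀ (a b : ℕ) (u : List.Vector ℕ n), (a ::ᵥ b ::ᵥ u).get (Fin.succ 0) = b :=
            fun a b u => by rw [List.Vector.get_cons_succ, List.Vector.get_cons_zero]
          rw [List.Vector.get_ofFn]
          exact h1.trans (hc _ _ v.tail).symm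
        · simp [hv, h3 _ (hr i.succ)]
      refine ((hq O s' W ?_).seq (fun s5 hs5 => (Runs.assign (Q := fun s' => s' (base + 2) 0 = m ∧
        s' base 0 = F (N - m) ∧ s' (base + 1) 0 = N - (m + 1) ∧ ∀ A < base, s' A = s A) ?_).seq
        fun s6 hs6 => Runs.assign ?_)).mono ?_ fun _ h => h
      · intro i
        have := vector_cons_ofFn_le (v := v.tail) ((by omega : N - (m + 1) ≤ b).trans hbW)
          (hFW (N - (m + 1)) (by omega)) (fun i => (hvt i).trans hbW) i
        rw [← hargs] at this
        simpa using this
      · rw [hargs] at hs5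
        refine ⟨?_, ?_, ?_, fun A hA => ?_⟩
        · rw [Memory.set_of_ne _ _ _ (by omega), hs5.2 _ (by omega), hx]
        · simp only [Memory.set_apply, eval_var, and_self, if_true, hs5.1, hF]
          rw [show N - m = N - (m + 1) + 1 by omega]
        · rw [Memory.set_of_ne _ _ _ (by omega), hs5.2 _ (by omega), h2]
        · rw [Memory.set_of_ne _ _ _ (by omega), hs5.2 _ (by omega), h3 A hA]
      · refine ⟨?_, ?_, ?_, fun A hA => ?_⟩
        · rw [Memory.set_of_ne _ _ _ (by omega), hs6.1]
        · rw [Memory.set_of_ne _ _ _ (by omega), hs6.2.1]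
        · simp only [Memory.set_apply, and_self, if_true, Expr.eval, eval_var, hs6.2.2.1]
          omega
        · rw [Memory.set_of_ne _ _ _ (by omega), hs6.2.2.2 A hA]
      · simp
    · rw [hvh]
      exact ⟨by simpa [hJ] using hs4.1, hs4.2.2⟩
    · have : N * (Tg W + 20) ≤ b * (Tg (recBound Tf Tg b b) + 20) := Nat.mul_le_mul_right _ hNb
      simp
      simp only [show Tg W + 11 + 9 = Tg W + 20 by omega]
      omega

theorem compilable_of_primrec' {m : ℕ} {f : List.Vector ℕ m → ℕ} (h : Nat.Primrec' f) :
    Compilable f := by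
  induction h with
  | zero => exact compilable_zero
  | succ => exact compilable_succ
  | get i => exact compilable_get i
  | comp g _ _ hf hg => exact compilable_comp hf hg
  | prec _ _ hf hg => exact compilable_prec hf hg

theorem compilable_of_primrec {m : ℕ} {f : List.Vector ℕ m → ℕ} (h : Primrec f) : Compilable f :=
  compilable_of_primrec' (Nat.Primrec'.of_prim h)

/-! ### Calling compiled functions -/

/-- The arrays before `100`, except those listed, are the same in both memories. -/
def Frame (l : List ℕ) (s s' : Memory) : Prop := ∀ A < 100, A ∉ l → s' A = s A

theorem Frame.refl (l : List ℕ) (s : Memory) : Frame l s s := fun _ _ _ => rfl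

theorem Frame.trans {l : List ℕ} {s s' s'' : Memory} (h : Frame l s s') (h' : Frame l s' s'') :
    Frame l s s'' := fun A hA hl => (h' A hA hl).trans (h A hA hl)

theorem Frame.mono {l l' : List ℕ} {s s' : Memory} (h : Frame l s s') (hl : l ⊆ l') :
    Frame l' s s' := fun A hA hA' => h A hA fun h' => hA' (hl h')

theorem Frame.set {l : List ℕ} {s s' : Memory} (h : Frame l s s') {A : ℕ} (hA : A ∈ l)
    (j v : ℕ) : Frame l s (s'.set A j v) := fun B hB hB' => by
  rw [Memory.set_of_ne _ _ _ fun e => hB' (by rw [e]; exact hA), h B hB hB']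

/-- `p` writes the value of `F` at the variables `x y z w` into variable `out`. -/
def Call (F : ℕ → ℕ → ℕ → ℕ → ℕ) (T : ℕ → ℕ) (p : Program) (x y z w out : ℕ) : Prop :=
  ∀ O s b, s x 0 ≤ b → s y 0 ≤ b → s z 0 ≤ b → s w 0 ≤ b → Runs O p s (T b) fun s' =>
    s' out 0 = F (s x 0) (s y 0) (s z 0) (s w 0) ∧ Frame [out] s s'

/-- Compiled code is placed in the arrays from 100 on and its result is copied down, so the named
variables of the main program survive. The copying accounts for the extra 4 in the time. Four
arguments suffice for all calls. -/
theorem exists_call {F : ℕ → ℕ → ℕ → ℕ → ℕ}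
    (hF : Primrec fun q : ℕ × ℕ × ℕ × ℕ => F q.1 q.2.1 q.2.2.1 q.2.2.2) :
    ∃ T : ℕ → ℕ, Primrec T ∧ Monotone T ∧
      (∀ x y z w b, x ≤ b → y ≤ b → z ≤ b → w ≤ b → F x y z w ≤ T b) ∧
      ∀ x y z w out, x < 100 → y < 100 → z < 100 → w < 100 → out < 100 →
        ∃ p, Call F T p x y z w out := by
  have hv : Primrec fun v : List.Vector ℕ 4 => F (v.get 0) (v.get 1) (v.get 2) (v.get 3) := by
    have h : ∀ i, Primrec fun v : List.Vector ℕ 4 => v.get i := fun i =>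
      Primrec.vector_get.comp Primrec.id (Primrec.const i)
    exact hF.comp ((h 0).pair ((h 1).pair ((h 2).pair (h 3))))
  obtain ⟨T, h1, h2, h3, h4⟩ := compilable_of_primrec hv
  refine ⟨fun b => T b + 4, by fun_prop, fun a b h => Nat.add_le_add_right (h2 h) 4, ?_, ?_⟩
  · intro x y z w b hx hy hz hw
    refine (h3 (x ::ᵥ y ::ᵥ z ::ᵥ w ::ᵥ .nil) b fun i => ?_).trans (by simp)
    fin_cases i <;> assumption
  · intro x y z w out hx hy hz hw hout
    obtain ⟨p, hp⟩ := h4 ![x, y, z, w] 100 fun i => by fin_cases i <;> assumption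
    refine ⟨.seq p (assign out (var 100)), fun O s b hx hy hz hw => ?_⟩
    refine (hp O s b fun i => by fin_cases i <;> assumption).seq fun s' hs' => Runs.assign ?_
    refine ⟨?_, fun A hA hA' => ?_⟩
    · simp [Memory.set_apply, hs'.1]
    · rw [Memory.set_of_ne _ _ _ (by simpa using hA'), hs'.2 A hA]

/-! ### What the program computes -/

namespace Instance
variable (I : Instance)

/-- The number of later agents of the same color. -/
def rank (j : Fin I.n) : ℕ := (univ.filter fun j' => j < j' ∧ I.color j' = I.color j).card

/-- The coalition that represents the profile with code `v`. -/
def rep (v : ℕ) : Finset (Fin I.n) :=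
  univ.filter fun j => I.rank j < dig (I.maxSize + 2) v (I.color j)

abbrev V : ℕ := numProf I.γ I.maxSize
abbrev R : ℕ := numRow I.γ I.maxSize

open Classical in
noncomputable def prefBit (i : Fin I.n) (q : ℕ) : ℕ :=
  if I.WeaklyPrefers i (I.rep (q / I.V)) (I.rep (q % I.V)) then 1 else 0

/-- The kind of an agent: its color and its preferences between small profiles. -/
noncomputable def kind (i : Fin I.n) : ℕ := bits (I.prefBit i) (I.color i) 0 (I.V * I.V)

/-- The right hand side of the integer program. -/
noncomputable def rhs (r : ℕ) : ℕ :=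
  if r < numKind I.γ I.maxSize then (univ.filter fun i => I.kind i = r).card
  -- A partition has at most n parts, so the minimum with n changes nothing and keeps the right-hand
  -- side within n binary levels.
  else if r = numKind I.γ I.maxSize then min I.maxCoalitions I.n
  else min I.maxNontrivial I.n

theorem input_color {j : ℕ} (h : j < I.n) : I.input 1 j = I.color ⟨j, h⟩ := by
  simp [input, h]

theorem rhs_le (r : ℕ) : I.rhs r ≤ I.n := by
  unfold rhs
  split_ifs
  · exact (card_le_univ _).trans (by simp)
  · exact min_le_right _ _
  · exact min_le_right _ _

end Instance

/-! ### The program -/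

/-- Array 4 counts the agents of each color seen so far. As the loop descends, these are the later
agents, and the count is the rank stored in array 3. -/
def rankLoop : Program :=
  forDown 19 (var 34) (.seq (.write 3 (var 19) (.read 4 (.read 1 (var 19))))
    (.write 4 (.read 1 (var 19)) (.add (.read 4 (.read 1 (var 19))) (.const 1))))

/-- List the members of the coalition representing a profile. -/
def listRep (len list : ℕ) (test : Program) : Program :=
  .seq (assign len (.const 0)) (forDown 19 (var 34) (.seq (assign 24 (.read 1 (var 19)))
    -- Double truncated subtraction gives the minimum of the rank and σ + 1. This keeps the argument
    -- of the compiled test bounded in the parameter and does not change its outcome, since digits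
    -- are at most σ + 1.
    (.seq (assign 25 (.sub (.read 3 (var 19))
        (.sub (.read 3 (var 19)) (.add (var 12) (.const 1)))))
      (.seq test (.ite (var 26) (.seq (.write list (var len) (var 19))
        (assign len (.add (var len) (.const 1)))) .skip)))))

def pairStep (test1 test2 : Program) : Program :=
  .seq (listRep 20 21 test1) (.seq (listRep 22 23 test2)
    (.seq (.query 26 (.const 0) (var 16) ⟨21, .const 0, var 20⟩ ⟨23, .const 0, var 22⟩)
      (assign 15 (.add (.add (var 15) (var 15)) (var 26)))))

/-- Variable 15 starts as the color and is doubled for every pair of profiles. Both loops descend,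
so the bits arrive from the highest to the lowest. The finished kind is the index of a counter in
array 5. -/
def kindStep (test1 test2 : Program) : Program :=
  .seq (assign 15 (.read 1 (var 16)))
    (.seq (forDown 17 (var 13) (forDown 18 (var 13) (pairStep test1 test2)))
      (.write 5 (var 15) (.add (.read 5 (var 15)) (.const 1))))

def countLoop (test1 test2 : Program) : Program :=
  .seq (forDown 16 (var 34) (kindStep test1 test2))
    -- The last two rows receive minima with n, again as `a - (a - n)`.
    (.seq (.write 5 (.sub (var 14) (.const 2))
        (.sub (.read 0 (.const 3)) (.sub (.read 0 (.const 3)) (var 34))))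
      (.write 5 (.sub (var 14) (.const 1))
        (.sub (.read 0 (.const 4)) (.sub (.read 0 (.const 4)) (var 34)))))

/-- Halve a cell of array `5`, remembering the remainder. -/
def halve : Program :=
  .seq (assign 31 (.const 0)) (.seq (assign 32 (.const 0))
    (.seq (forDown 33 (.read 5 (var 30)) (.ite (var 32)
        (.seq (assign 32 (.const 0)) (assign 31 (.add (var 31) (.const 1))))
        (assign 32 (.const 1))))
      (.write 5 (var 30) (var 31))))

/-- Halving every right-hand side in place yields the bits of the current level as remainders and
prepares the next level. -/
def maskLoop : Program :=
  .seq (assign 28 (.const 0)) (forDown 30 (var 14)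
    (.seq halve (assign 28 (.add (.add (var 28) (var 28)) (var 32)))))

def levelLoop (init step : Program) : Program :=
  .seq init (forDown 29 (var 34) (.seq maskLoop step))

/-- Variables 11, 12 and 34 hold γ, σ and n; `profs` and `rows` are meant to fill 13 and 14 with the
numbers of profiles and rows. -/
def decideProgram (profs rows test1 test2 init step acc : Program) : Program :=
  .seq (.seq (assign 11 (.read 0 (.const 1))) (.seq (assign 12 (.read 0 (.const 2)))
    (.seq (assign 34 (.read 0 (.const 0))) (.seq profs rows))))
    (.seq rankLoop (.seq (countLoop test1 test2) (.seq (levelLoop init step) acc)))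

/-! ### Correctness of the program -/

section Correctness
variable {I : Instance} {O : ℕ → List ℕ → List ℕ → ℕ} {s : Memory}

theorem card_filter_le_step (I : Instance) {m : ℕ} (hm : m < I.n) (p : Fin I.n → Prop)
    [DecidablePred p] :
    (univ.filter fun j : Fin I.n => m ≤ (j : ℕ) ∧ p j).card =
      (univ.filter fun j : Fin I.n => m + 1 ≤ (j : ℕ) ∧ p j).card + if p ⟨m, hm⟩ then 1 else 0 := by
  split_ifs with h
  · rw [← card_insert_of_notMem (a := (⟨m, hm⟩ : Fin I.n)) (by simp)]
    congr 1
    ext j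
    simp only [mem_filter, mem_univ, true_and, mem_insert, Fin.ext_iff]
    constructor
    · rintro ⟨h1, h2⟩
      by_cases h3 : (j : ℕ) = m
      · exact .inl h3
      · exact .inr ⟨by omega, h2⟩
    · rintro (h1 | h1)
      · have : j = ⟨m, hm⟩ := Fin.ext h1
        subst this
        exact ⟨le_rfl, h⟩
      · exact ⟨by omega, h1.2⟩
  · rw [add_zero]
    congr 1
    ext j
    simp only [mem_filter, mem_univ, true_and]
    constructor
    · rintro ⟨h1, h2⟩
      refine ⟨?_, h2⟩
      by_contra h3
      have : j = ⟨m, hm⟩ := Fin.ext (by dsimp only; omega)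
      exact h (this ▸ h2)
    · exact fun h1 => ⟨by omega, h1.2⟩

theorem runs_rankLoop (h1 : s 1 = I.input 1) (h34 : s 34 0 = I.n) (h4 : ∀ c, s 4 c = 0) :
    Runs O rankLoop s (10 + I.n * 40) fun s' =>
      (∀ j (h : j < I.n), s' 3 j = I.rank ⟨j, h⟩) ∧ Frame [3, 4, 19] s s' := by
  set J : ℕ → Memory → Prop := fun m s' =>
    (∀ j (h : j < I.n), m ≤ j → s' 3 j = I.rank ⟨j, h⟩) ∧
    (∀ c, s' 4 c = (univ.filter fun j : Fin I.n => m ≤ (j : ℕ) ∧ (I.color j : ℕ) = c).card) ∧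
    Frame [3, 4, 19] s s' with hJ
  refine (Runs.forDown (T := 26) J (N := I.n) (by simp [h34]) ?_ ?_ ?_).mono (by simp; omega)
    fun s' h => ⟨fun j hj => h.1 j hj (Nat.zero_le j), h.2.2⟩
  · rintro m - s' v ⟨a, b, c⟩
    exact ⟨fun j h hm => by rw [Memory.set_of_ne _ _ _ (by decide), a j h hm],
      fun c => by rw [Memory.set_of_ne _ _ _ (by decide), b c], c.set (by decide) _ _⟩
  · refine ⟨fun j h hm => by omega, fun c => ?_, Frame.refl _ _⟩
    rw [h4, eq_comm, card_eq_zero, filter_eq_empty_iff]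
    rintro j - ⟨h, -⟩
    have := j.2
    omega
  · rintro m hm s' ⟨a, b, c⟩ hx
    have h1' : s' 1 m = I.color ⟨m, hm⟩ := by
      rw [c 1 (by decide) (by decide), h1, I.input_color hm]
    refine ((Runs.write (Q := fun s'' => s'' = s'.set 3 m (s' 4 (s' 1 m))) (by simp [hx])).seq
      fun s'' hs'' => Runs.write ?_).mono (by simp) fun _ h => h
    subst hs''
    refine ⟨by simp [Memory.set_apply, hx], fun j h hj => ?_, fun x => ?_, ?_⟩
    · rw [Memory.set_of_ne _ _ _ (by decide)]
      by_cases hjm : j = m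
      · subst hjm
        simp only [Memory.set_apply, and_self, if_true, b, h1', Instance.rank]
        congr 1
        ext j'
        simp [Fin.lt_def, Fin.ext_iff]
      · simp only [Memory.set_apply, hjm, and_false, if_false]
        exact a j h (by omega)
    · rw [card_filter_le_step I hm]
      simp only [Memory.set_apply, Expr.eval, eval_var, hx, h1', b]
      by_cases hc : (I.color ⟨m, hm⟩ : ℕ) = x
      · simp [h1', hc]
      · simp [h1', hc, Ne.symm hc]
    · exact (c.set (by decide) _ _).set (by decide) _ _

/-- The arrays that stay constant after the preparations have the right contents. -/
structure Ready (I : Instance) (s : Memory) : Prop where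
  input : s 0 = I.input 0
  color : s 1 = I.input 1
  rank : ∀ j (h : j < I.n), s 3 j = I.rank ⟨j, h⟩
  γ : s 11 0 = I.γ
  σ : s 12 0 = I.maxSize
  V : s 13 0 = I.V
  R : s 14 0 = I.R
  n : s 34 0 = I.n

theorem Ready.frame {l : List ℕ} {s' : Memory} (h : Ready I s) (hf : Frame l s s')
    (hl : ∀ A ∈ [0, 1, 3, 11, 12, 13, 14, 34], A ∉ l) : Ready I s' := by
  have e : ∀ A ∈ [0, 1, 3, 11, 12, 13, 14, 34], s' A = s A := fun A hA =>
    hf A (by revert A; decide) (hl A hA)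
  constructor
  · rw [e 0 (by decide), h.input]
  · rw [e 1 (by decide), h.color]
  · rw [e 3 (by decide)]; exact h.rank
  · rw [e 11 (by decide), h.γ]
  · rw [e 12 (by decide), h.σ]
  · rw [e 13 (by decide), h.V]
  · rw [e 14 (by decide), h.R]
  · rw [e 34 (by decide), h.n]

/-- The number `d` distinguishes the two coalitions of a query, which use separate lists and
separate profile variables. The loop invariant says that the list holds exactly the members among
the agents already visited. -/
theorem runs_listRep {T : ℕ → ℕ} {b : ℕ} (d : ℕ) (hd : d ≤ 1) {test : Program}
    (htest : Call (fun σ v c a => repTest σ v c a) T test 12 (17 + d) 24 25 26)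
    (hs : Ready I s) (hb : s (17 + d) 0 ≤ b) (hσ : I.maxSize + 1 ≤ b) (hγ : I.γ ≤ b) :
    Runs O (listRep (20 + 2 * d) (21 + 2 * d) test) s (20 + I.n * (T b + 60)) fun s' =>
      (∀ x, (∃ k < s' (20 + 2 * d) 0, s' (21 + 2 * d) k = x) ↔
        ∃ h : x < I.n, (⟨x, h⟩ : Fin I.n) ∈ I.rep (s (17 + d) 0)) ∧
      Frame [19, 20 + 2 * d, 21 + 2 * d, 24, 25, 26] s s' := by
  set l := [19, 20 + 2 * d, 21 + 2 * d, 24, 25, 26] with hl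
  set v := s (17 + d) 0 with hv
  set J : ℕ → Memory → Prop := fun m s' =>
    (∀ x, (∃ k < s' (20 + 2 * d) 0, s' (21 + 2 * d) k = x) ↔
      ∃ h : x < I.n, m ≤ x ∧ (⟨x, h⟩ : Fin I.n) ∈ I.rep v) ∧ Frame l s s' with hJ
  have hready : ∀ s', Frame l s s' → Ready I s' := fun s' hf => hs.frame hf (by
    intro A hA; simp [hl] at hA ⊢; omega)
  refine ((Runs.assign (Q := J I.n) ?_).seq fun s' hs' => (Runs.forDown (T := T b + 45) J
    (N := I.n) (by simp [(hready s' hs'.2).n]) ?_ hs' ?_).mono le_rfl fun s' h => ?_).mono ?_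
    fun _ h => h
  · refine ⟨fun x => ?_, (Frame.refl _ _).set (by simp [hl]) _ _⟩
    simp only [Memory.set_apply, and_self, if_true, Expr.eval]
    exact ⟨fun ⟨k, hk, _⟩ => absurd hk (by omega), fun ⟨h1, h2, _⟩ => by omega⟩
  · rintro m - s' w ⟨h1, h2⟩
    refine ⟨fun x => ?_, h2.set (by simp [hl]) _ _⟩
    rw [Memory.set_of_ne _ _ _ (by omega), Memory.set_of_ne _ _ _ (by omega), h1]
  · rintro m hm s' ⟨h1, h2⟩ hx
    have hr := hready s' h2
    set c := (I.color ⟨m, hm⟩ : ℕ)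
    set a := I.rank ⟨m, hm⟩
    set a' := a - (a - (I.maxSize + 1)) with ha'
    have hc : c < I.γ := (I.color ⟨m, hm⟩).2
    have e1 : s' 1 m = c := by rw [hr.color, I.input_color hm]
    have e3 : s' 3 m = a := hr.rank m hm
    have e17 : s' (17 + d) 0 = v := by
      rw [h2 _ (by omega) (by simp [hl]; omega)]
    have hne : ∀ {A x : ℕ} (t : Memory) (w : ℕ), A ≠ x → (t.set x 0 w) A = t A :=
      fun t w h => Memory.set_of_ne _ _ _ h
    -- Capping is harmless: a rank of at least σ + 1 fails the comparison with the digit before and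
    -- after it.
    have hmem : (repTest I.maxSize v c a' ≠ 0) ↔ (⟨m, hm⟩ : Fin I.n) ∈ I.rep v := by
      have := dig_lt (b := I.maxSize + 2) (by omega) v c
      simp only [repTest, Instance.rep, mem_filter, mem_univ, true_and]
      change _ ↔ a < dig (I.maxSize + 2) v c
      split_ifs <;> simp <;> omega
    set K : Memory → Prop := fun t => t 19 0 = m ∧ t (20 + 2 * d) 0 = s' (20 + 2 * d) 0 ∧
      t (21 + 2 * d) = s' (21 + 2 * d) ∧ Frame l s t with hK
    refine ((Runs.assign (Q := fun t => K t ∧ t 24 0 = c) ?_).seq fun t1 ht1 =>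
      (Runs.assign (Q := fun t => K t ∧ t 24 0 = c ∧ t 25 0 = a') ?_).seq fun t2 ht2 =>
      (((htest O t2 b ?_ ?_ ?_ ?_).mono le_rfl
        (R := fun t => K t ∧ t 26 0 = repTest I.maxSize v c a') fun t ht => ?_).seq fun t3 ht3 =>
      (Runs.ite (T := 20) (fun hne0 => ?_) (fun heq0 => ?_)))).mono (by simp; omega) fun _ h => h
    · refine ⟨⟨?_, ?_, ?_, h2.set (by simp [hl]) _ _⟩, ?_⟩
      · rw [hne _ _ (by decide), hx]
      · rw [hne _ _ (by omega)]
      · rw [hne _ _ (by omega)]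
      · simp [Memory.set_apply, hx, e1]
    · have hr1 := hready t1 ht1.1.2.2.2
      refine ⟨⟨?_, ?_, ?_, ht1.1.2.2.2.set (by simp [hl]) _ _⟩, ?_, ?_⟩
      · rw [hne _ _ (by decide), ht1.1.1]
      · rw [hne _ _ (by omega), ht1.1.2.1]
      · rw [hne _ _ (by omega), ht1.1.2.2.1]
      · rw [hne _ _ (by decide), ht1.2]
      · simp [Memory.set_apply, ht1.1.1, hr1.rank m hm, hr1.σ, ha', a]
    · rw [(hready t2 ht2.1.2.2.2).σ]; omega
    · rw [ht2.1.2.2.2 _ (by omega) (by simp [hl]; omega)]; exact hb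
    · rw [ht2.2.1]; omega
    · rw [ht2.2.2]; omega
    · have e17' : t2 (17 + d) 0 = v := by
        rw [ht2.1.2.2.2 _ (by omega) (by simp [hl]; omega)]
      refine ⟨⟨?_, ?_, ?_, ht2.1.2.2.2.trans (ht.2.mono (by simp [hl]))⟩, ?_⟩
      · rw [ht.2 _ (by decide) (by decide), ht2.1.1]
      · rw [ht.2 _ (by omega) (by simp; omega), ht2.1.2.1]
      · rw [ht.2 _ (by omega) (by simp; omega), ht2.1.2.2.1]
      · rw [ht.1, (hready t2 ht2.1.2.2.2).σ, e17', ht2.2.1, ht2.2.2]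
    · have hm' := hmem.1 (by rw [← ht3.2]; exact hne0)
      obtain ⟨⟨k1, k2, k3, k4⟩, -⟩ := ht3
      refine ((Runs.write (Q := fun t => t = t3.set (21 + 2 * d) (s' (20 + 2 * d) 0) m)
        (by simp [k1, k2])).seq fun t4 ht4 => Runs.assign ?_).mono (by simp) fun _ h => h
      subst ht4
      refine ⟨?_, fun x => ?_, (k4.set (by simp [hl]) _ _).set (by simp [hl]) _ _⟩
      · rw [hne _ _ (by omega), Memory.set_of_ne _ _ _ (by omega), k1]
      · have f1 : ∀ w, ((t3.set (21 + 2 * d) (s' (20 + 2 * d) 0) m).set (20 + 2 * d) 0 w)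
            (21 + 2 * d) = (t3.set (21 + 2 * d) (s' (20 + 2 * d) 0) m) (21 + 2 * d) :=
          fun w => Memory.set_of_ne _ _ _ (by omega)
        rw [f1]
        have f2 : (t3.set (21 + 2 * d) (s' (20 + 2 * d) 0) m) (20 + 2 * d) 0
            = s' (20 + 2 * d) 0 := by rw [Memory.set_of_ne _ _ _ (by omega), k2]
        simp only [Memory.set_apply _ (20 + 2 * d), and_self, if_true, Expr.eval, eval_var, f2]
        simp only [Memory.set_apply, true_and, k3]
        have h1x := h1 x
        constructor
        · rintro ⟨k, hk, hkx⟩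
          by_cases hkl : k = s' (20 + 2 * d) 0
          · rw [if_pos hkl] at hkx
            subst hkx
            exact ⟨hm, le_rfl, hm'⟩
          · rw [if_neg hkl] at hkx
            obtain ⟨g1, g2, g3⟩ := h1x.1 ⟨k, by omega, hkx⟩
            exact ⟨g1, by omega, g3⟩
        · rintro ⟨g1, g2, g3⟩
          by_cases hxm : x = m
          · exact ⟨_, Nat.lt_succ_self _, by rw [if_pos rfl, hxm]⟩
          · obtain ⟨k, hk, hkx⟩ := h1x.2 ⟨g1, by omega, g3⟩
            exact ⟨k, by omega, by rw [if_neg (by omega), hkx]⟩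
    · have hm' : (⟨m, hm⟩ : Fin I.n) ∉ I.rep v := fun h => hmem.2 h (by rw [← ht3.2]; exact heq0)
      obtain ⟨⟨k1, k2, k3, k4⟩, -⟩ := ht3
      refine (Runs.skip ⟨k1, fun x => ?_, k4⟩).mono (by decide) fun _ h => h
      rw [k2, k3, h1 x]
      refine exists_congr fun hx' => and_congr_left fun hxm => ⟨fun h => by omega, fun h => ?_⟩
      rcases h.eq_or_lt with h | h
      · subst h
        exact absurd hxm hm'
      · exact h
  · refine ⟨fun x => ?_, h.2⟩
    rw [h.1 x]
    simp
  · simp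
    have : T b + 45 + 9 ≤ T b + 60 := by omega
    have := Nat.mul_le_mul_left I.n this
    omega

theorem coalition_segment {t : Memory} {list len : ℕ} {C : Finset (Fin I.n)}
    (h : ∀ x, (∃ k < t len 0, t list k = x) ↔ ∃ h : x < I.n, (⟨x, h⟩ : Fin I.n) ∈ C) :
    I.coalition (Segment.eval t ⟨list, .const 0, var len⟩) = C := by
  ext j
  simp only [Instance.coalition, mem_filter, mem_univ, true_and, Segment.eval, List.mem_map,
    List.mem_range, eval_var, Expr.eval, zero_add]
  rw [h j]
  exact ⟨fun ⟨_, h⟩ => h, fun h => ⟨j.2, h⟩⟩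

open Classical in
theorem oracle_eq (i : Fin I.n) {L L' : List ℕ} {C D : Finset (Fin I.n)}
    (hC : I.coalition L = C) (hD : I.coalition L' = D) :
    I.oracle i L L' = if I.WeaklyPrefers i C D then 1 else 0 := by
  subst hC hD
  simp [Instance.oracle]

def pairTime (n T : ℕ) : ℕ := 60 + n * (2 * (T + 60))

theorem runs_pairStep {T : ℕ → ℕ} {b : ℕ} {test1 test2 : Program}
    (htest1 : Call (fun σ v c a => repTest σ v c a) T test1 12 17 24 25 26)
    (htest2 : Call (fun σ v c a => repTest σ v c a) T test2 12 18 24 25 26)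
    (hs : Ready I s) (hV : I.V ≤ b) (hσ : I.maxSize + 1 ≤ b) (hγ : I.γ ≤ b) (i : Fin I.n)
    (hi : s 16 0 = i) {v w : ℕ} (hv : v < I.V) (hw : w < I.V) (h17 : s 17 0 = v)
    (h18 : s 18 0 = w) :
    Runs I.oracle (pairStep test1 test2) s (pairTime I.n (T b)) fun s' =>
      s' 15 0 = I.prefBit i (v * I.V + w) + 2 * s 15 0 ∧
      Frame [15, 19, 20, 21, 22, 23, 24, 25, 26] s s' := by
  have hq : (v * I.V + w) / I.V = v ∧ (v * I.V + w) % I.V = w := by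
    rw [mul_comm, Nat.mul_add_div (by omega), Nat.div_eq_of_lt hw, Nat.mul_add_mod,
      Nat.mod_eq_of_lt hw]
    simp
  refine ((runs_listRep 0 (by omega) htest1 hs (by rw [h17]; omega) hσ hγ).seq fun s1 h1 =>
    ((runs_listRep 1 le_rfl htest2 (hs.frame h1.2 (by decide)) ?_ hσ hγ).seq fun s2 h2 =>
    (Runs.query (Q := fun t => t 26 0 = I.prefBit i (v * I.V + w) ∧ t 15 0 = s 15 0 ∧
      Frame [15, 19, 20, 21, 22, 23, 24, 25, 26] s t) ?_).seq fun s3 h3 =>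
    Runs.assign ?_)).mono ?_ fun _ h => h
  · rw [h1.2 _ (by decide) (by decide)]
    simp only [Nat.reduceAdd]
    omega
  · have f1 := h1.2
    have f2 := h2.2
    simp only [Nat.reduceAdd, Nat.reduceMul] at f1 f2 h1 h2
    have c1 : I.coalition (Segment.eval s2 ⟨21, .const 0, var 20⟩) = I.rep v :=
      coalition_segment (C := I.rep v) (by
        rw [f2 20 (by decide) (by decide), f2 21 (by decide) (by decide)]
        intro x
        rw [h1.1 x, h17])
    have c2 : I.coalition (Segment.eval s2 ⟨23, .const 0, var 22⟩) = I.rep w :=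
      coalition_segment (C := I.rep w) (by
        intro x
        rw [h2.1 x, f1 18 (by decide) (by decide), h18])
    have h16 : s2 16 0 = i := by
      rw [f2 16 (by decide) (by decide), f1 16 (by decide) (by decide), hi]
    refine ⟨?_, ?_, ?_⟩
    · simp only [Memory.set_apply, Expr.eval, and_self, if_true, eval_var, h16,
        oracle_eq i c1 c2, Instance.prefBit]
      rw [hq.1, hq.2]
    · rw [Memory.set_of_ne _ _ _ (by decide), f2 15 (by decide) (by decide),
        f1 15 (by decide) (by decide)]
    · exact ((f1.mono (by decide)).trans (f2.mono (by decide))).set (by decide) _ _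
  · refine ⟨?_, h3.2.2.set (by decide) _ _⟩
    simp only [Memory.set_apply, and_self, if_true, Expr.eval, eval_var, h3.1, h3.2.1]
    omega
  · simp [Segment.cost, pairTime]
    linarith

def kindTime (n V T : ℕ) : ℕ := 20 + V * (16 + V * (pairTime n T + 9))

theorem bits_step (f : ℕ → ℕ) (a : ℕ) {p N : ℕ} (h : p < N) :
    bits f a p (N - p) = f p + 2 * bits f a (p + 1) (N - (p + 1)) := by
  rw [show N - p = N - (p + 1) + 1 by omega, bits]

theorem runs_kindStep {T : ℕ → ℕ} {b : ℕ} {test1 test2 : Program}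
    (htest1 : Call (fun σ v c a => repTest σ v c a) T test1 12 17 24 25 26)
    (htest2 : Call (fun σ v c a => repTest σ v c a) T test2 12 18 24 25 26)
    (hs : Ready I s) (hV : I.V ≤ b) (hσ : I.maxSize + 1 ≤ b) (hγ : I.γ ≤ b) (i : Fin I.n)
    (hi : s 16 0 = i) :
    Runs I.oracle (kindStep test1 test2) s (kindTime I.n I.V (T b)) fun s' =>
      (∀ A, s' 5 A = s 5 A + if A = I.kind i then 1 else 0) ∧
      Frame [5, 15, 17, 18, 19, 20, 21, 22, 23, 24, 25, 26] s s' := by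
  set l := [15, 17, 18, 19, 20, 21, 22, 23, 24, 25, 26] with hl
  have hr : ∀ s', Frame l s s' → Ready I s' := fun s' hf => hs.frame hf (by decide)
  -- This is the content of variable 15 once the bits from position p upwards are known; at 0 it is
  -- the kind. The pair (v, w) determines position v · V + w.
  set κ : ℕ → ℕ := fun p => bits (I.prefBit i) (I.color i) p (I.V * I.V - p) with hκ
  set J : ℕ → Memory → Prop := fun p t => t 15 0 = κ p ∧ Frame l s t with hJ
  refine ((Runs.assign (Q := J (I.V * I.V)) ?_).seq fun s1 h1 =>
    ((Runs.forDown (N := I.V) (T := 7 + I.V * (pairTime I.n (T b) + 9)) (fun v => J (v * I.V))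
      (by simp [(hr s1 h1.2).V]) ?_ h1 ?_).seq fun s2 h2 => Runs.write ?_)).mono ?_ fun _ h => h
  · refine ⟨?_, (Frame.refl _ _).set (by decide) _ _⟩
    simp [Memory.set_apply, hi, hs.color, I.input_color i.2, hκ, bits]
  · rintro m - t w ⟨h1, h2⟩
    exact ⟨by rw [Memory.set_of_ne _ _ _ (by decide), h1], h2.set (by decide) _ _⟩
  · rintro v hv t ht h17
    refine (Runs.forDown (N := I.V) (T := pairTime I.n (T b))
      (fun w t => J (v * I.V + w) t ∧ t 17 0 = v) (by simp [(hr t ht.2).V]) ?_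
      ⟨by rw [← Nat.succ_mul]; exact ht, h17⟩ ?_).mono (by simp) fun t' h => ⟨h.2, h.1⟩
    · rintro m - t w ⟨⟨h1, h2⟩, h3⟩
      exact ⟨⟨by rw [Memory.set_of_ne _ _ _ (by decide), h1], h2.set (by decide) _ _⟩,
        by rw [Memory.set_of_ne _ _ _ (by decide), h3]⟩
    · rintro w hw t ⟨⟨h1, h2⟩, h3⟩ h18
      refine (runs_pairStep htest1 htest2 (hr t h2) hV hσ hγ i
        (by rw [h2 16 (by decide) (by decide), hi]) hv hw h3 h18).mono le_rfl fun t' ht' =>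
        ⟨by rw [ht'.2 18 (by decide) (by decide), h18],
          ⟨?_, h2.trans (ht'.2.mono (by decide))⟩,
          by rw [ht'.2 17 (by decide) (by decide), h3]⟩
      have hlt : v * I.V + w < I.V * I.V := by
        have := Nat.mul_le_mul_right I.V (Nat.succ_le_of_lt hv)
        rw [Nat.succ_mul] at this
        omega
      rw [ht'.1, h1]
      exact (bits_step _ _ hlt).symm
  · have hk : s2 15 0 = I.kind i := by simpa [hκ, Instance.kind] using h2.1
    refine ⟨fun A => ?_, (h2.2.mono (by decide)).set (by decide) _ _⟩
    have h5 : s2 5 = s 5 := h2.2 5 (by decide) (by decide)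
    simp only [Memory.set_apply, Expr.eval, eval_var, hk, true_and, h5]
    by_cases hA : A = I.kind i <;> simp [hA]
  · simp [kindTime]
    have : I.V * (7 + I.V * (pairTime I.n (T b) + 9) + 9)
      = I.V * (16 + I.V * (pairTime I.n (T b) + 9)) := by ring
    omega

theorem runs_countLoop {T : ℕ → ℕ} {b : ℕ} {test1 test2 : Program}
    (htest1 : Call (fun σ v c a => repTest σ v c a) T test1 12 17 24 25 26)
    (htest2 : Call (fun σ v c a => repTest σ v c a) T test2 12 18 24 25 26)
    (hs : Ready I s) (hV : I.V ≤ b) (hσ : I.maxSize + 1 ≤ b) (hγ : I.γ ≤ b)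
    (h5 : ∀ A, s 5 A = 0) :
    Runs I.oracle (countLoop test1 test2) s (40 + I.n * (kindTime I.n I.V (T b) + 9)) fun s' =>
      Ready I s' ∧ ∀ r < I.R, s' 5 r = I.rhs r := by
  set l := [5, 15, 16, 17, 18, 19, 20, 21, 22, 23, 24, 25, 26] with hl
  have hr : ∀ s', Frame l s s' → Ready I s' := fun s' hf => hs.frame hf (by decide)
  set J : ℕ → Memory → Prop := fun m t =>
    (∀ A, t 5 A = (univ.filter fun i : Fin I.n => m ≤ (i : ℕ) ∧ I.kind i = A).card) ∧
      Frame l s t with hJ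
  refine ((Runs.forDown (N := I.n) (T := kindTime I.n I.V (T b)) J (by simp [hs.n]) ?_ ?_ ?_).seq
    fun s1 h1 => (Runs.write (Q := fun t => t = s1.set 5 (numKind I.γ I.maxSize)
      (min I.maxCoalitions I.n)) ?_).seq fun s2 h2 => Runs.write ?_).mono ?_ fun _ h => h
  · rintro m - t w ⟨h1, h2⟩
    exact ⟨by rw [Memory.set_of_ne _ _ _ (by decide)]; exact h1, h2.set (by decide) _ _⟩
  · refine ⟨fun A => ?_, Frame.refl _ _⟩
    rw [h5, eq_comm, card_eq_zero, filter_eq_empty_iff]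
    rintro j - ⟨h, -⟩
    have := j.2
    omega
  · rintro m hm t ⟨h1, h2⟩ h16
    refine (runs_kindStep htest1 htest2 (hr t h2) hV hσ hγ ⟨m, hm⟩ h16).mono le_rfl
      fun t' ht' => ⟨by rw [ht'.2 16 (by decide) (by decide), h16], fun A => ?_,
        h2.trans (ht'.2.mono (by decide))⟩
    rw [ht'.1, h1, card_filter_le_step I hm]
    simp only [eq_comm]
  · have hR := (hr s1 h1.2)
    have e1 : s1 14 0 - 2 = numKind I.γ I.maxSize := by rw [hR.R]; simp [numRow]
    have e2 : s1 0 3 - (s1 0 3 - s1 34 0) = min I.maxCoalitions I.n := by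
      rw [hR.input, hR.n]
      simp [Instance.input]
      omega
    simp [e1, e2]
  · have hR := (hr s1 h1.2)
    subst h2
    have hne : ∀ {A : ℕ} (t : Memory) (j w : ℕ), A ≠ 5 → (t.set 5 j w) A = t A :=
      fun t j w h => Memory.set_of_ne _ _ _ h
    refine ⟨hr _ ((h1.2.set (by decide) _ _).set (by decide) _ _), fun r hr => ?_⟩
    have e1 : s1 14 0 - 1 = numKind I.γ I.maxSize + 1 := by rw [hR.R]; simp [numRow]
    have e2 : s1 0 4 - (s1 0 4 - s1 34 0) = min I.maxNontrivial I.n := by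
      rw [hR.input, hR.n]
      simp [Instance.input]
      omega
    simp only [Expr.eval, eval_var]
    rw [hne (A := 14) _ _ _ (by decide), hne (A := 34) _ _ _ (by decide),
      hne (A := 0) _ _ _ (by decide), e1, e2]
    simp only [Memory.set_apply, true_and, Instance.rhs, h1.1]
    have : r < numKind I.γ I.maxSize + 2 := hr
    by_cases c1 : r < numKind I.γ I.maxSize
    · rw [if_neg (by omega), if_neg (by omega), if_pos c1]
      simp
    · by_cases c2 : r = numKind I.γ I.maxSize
      · rw [if_neg (by omega), if_pos c2, if_neg c1, if_pos c2]
      · rw [if_pos (by omega), if_neg c1, if_neg c2]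
  · simp
    omega

theorem runs_halve {r N : ℕ} (hr : s 30 0 = r) (hN : s 5 r = N) :
    Runs O halve s (19 + N * 21) fun s' =>
      (∀ x, s' 5 x = if x = r then N / 2 else s 5 x) ∧ s' 32 0 = N % 2 ∧
        Frame [5, 31, 32, 33] s s' := by
  -- Without division, quotient and remainder are found by counting: variable 32 toggles, and each
  -- return to 0 raises variable 31.
  set J : ℕ → Memory → Prop := fun m t =>
    t 31 0 = (N - m) / 2 ∧ t 32 0 = (N - m) % 2 ∧ Frame [31, 32, 33] s t with hJ
  refine ((Runs.assign (Q := fun t => t 31 0 = 0 ∧ Frame [31, 32, 33] s t) ?_).seq fun s1 h1 =>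
    (Runs.assign (Q := J N) ?_).seq fun s2 h2 =>
    (Runs.forDown (N := N) (T := 12) J ?_ ?_ h2 ?_).seq fun s3 h3 => Runs.write ?_).mono ?_
    fun _ h => h
  · exact ⟨by simp [Memory.set_apply], (Frame.refl _ _).set (by decide) _ _⟩
  · exact ⟨by simp [Memory.set_apply, h1.1], by simp [Memory.set_apply],
      h1.2.set (by decide) _ _⟩
  · simp [h2.2.2 5 (by decide) (by decide), h2.2.2 30 (by decide) (by decide), hr, hN]
  · rintro m - t w ⟨h1, h2, h3⟩
    exact ⟨by rw [Memory.set_of_ne _ _ _ (by decide), h1],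
      by rw [Memory.set_of_ne _ _ _ (by decide), h2], h3.set (by decide) _ _⟩
  · rintro m hm t ⟨h1, h2, h3⟩ h33
    refine (Runs.ite (T := 9) (fun h => ?_) fun h => ?_).mono (by simp) fun _ h => h
    · have h' : (N - (m + 1)) % 2 = 1 := by
        have : t 32 0 ≠ 0 := h
        omega
      refine ((Runs.assign (Q := fun t' => t' = t.set 32 0 0) (by simp)).seq fun t' ht' =>
        Runs.assign ?_).mono (by simp) fun _ h => h
      subst ht'
      refine ⟨by simp [Memory.set_apply, h33], ?_, ?_, (h3.set (by decide) _ _).set (by decide) _ _⟩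
      · simp [Memory.set_apply, h1]
        omega
      · simp [Memory.set_apply]
        omega
    · have h' : (N - (m + 1)) % 2 = 0 := by
        have : t 32 0 = 0 := h
        omega
      refine (Runs.assign ?_).mono (by simp) fun _ h => h
      refine ⟨by simp [Memory.set_apply, h33], ?_, ?_, h3.set (by decide) _ _⟩
      · simp [Memory.set_apply, h1]
        omega
      · simp [Memory.set_apply]
        omega
  · refine ⟨fun x => ?_, ?_, (h3.2.2.mono (by decide)).set (by decide) _ _⟩
    · simp [Memory.set_apply, h3.2.2 5 (by decide) (by decide),
        h3.2.2 30 (by decide) (by decide), hr, h3.1]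
    · simpa [Memory.set_apply] using h3.2.1
  · simp
    omega

theorem runs_maskLoop {N : ℕ → ℕ} {n t γ σ : ℕ} (hN : ∀ r, N r ≤ n)
    (hR : s 14 0 = numRow γ σ) (h5 : ∀ r < numRow γ σ, s 5 r = N r / 2 ^ t) :
    Runs O maskLoop s (10 + numRow γ σ * (n * 21 + 40)) fun s' =>
      s' 28 0 = levelMask γ σ N t ∧ (∀ r < numRow γ σ, s' 5 r = N r / 2 ^ (t + 1)) ∧
      Frame [5, 28, 30, 31, 32, 33] s s' := by
  set l := [5, 28, 30, 31, 32, 33] with hl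
  set f : ℕ → ℕ := fun r => N r / 2 ^ t % 2 with hf
  set J : ℕ → Memory → Prop := fun m t' => t' 28 0 = bits f 0 m (numRow γ σ - m) ∧
    (∀ r < numRow γ σ, t' 5 r = if m ≤ r then N r / 2 ^ (t + 1) else N r / 2 ^ t) ∧
    Frame l s t' with hJ
  refine ((Runs.assign (Q := J (numRow γ σ)) ?_).seq fun s1 h1 =>
    (Runs.forDown (N := numRow γ σ) (T := n * 21 + 29) J ?_ ?_ h1 ?_).mono le_rfl
      fun s2 h2 => ?_).mono ?_ fun _ h => h
  · refine ⟨by simp [Memory.set_apply, bits], fun r hr => ?_, (Frame.refl _ _).set (by decide) _ _⟩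
    rw [Memory.set_of_ne _ _ _ (by decide), if_neg (by omega), h5 r hr]
  · simp [h1.2.2 14 (by decide) (by decide), hR]
  · rintro m - t w ⟨h1, h2, h3⟩
    exact ⟨by rw [Memory.set_of_ne _ _ _ (by decide), h1],
      by rw [Memory.set_of_ne _ _ _ (by decide)]; exact h2, h3.set (by decide) _ _⟩
  · rintro m hm t' ⟨h1, h2, h3⟩ h30
    have hm5 : t' 5 m = N m / 2 ^ t := by rw [h2 m hm, if_neg (by omega)]
    refine ((runs_halve h30 hm5).seq fun t1 ht1 => Runs.assign ?_).mono ?_ fun _ h => h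
    · refine ⟨?_, ?_, fun r hr => ?_, (h3.trans (ht1.2.2.mono (by decide))).set (by decide) _ _⟩
      · rw [Memory.set_of_ne _ _ _ (by decide), ht1.2.2 30 (by decide) (by decide), h30]
      · rw [bits_step _ _ hm]
        simp only [Memory.set_apply, and_self, if_true, Expr.eval, eval_var, ht1.2.1,
          ht1.2.2 28 (by decide) (by decide), h1, hf]
        omega
      · rw [Memory.set_of_ne _ _ _ (by decide), ht1.1, h2 r hr]
        by_cases hrm : r = m
        · rw [if_pos hrm, if_pos hrm.ge, hrm, pow_succ, Nat.div_div_eq_div_mul]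
        · rw [if_neg hrm]
          by_cases hle : m ≤ r
          · rw [if_pos hle, if_pos (by omega)]
          · rw [if_neg hle, if_neg (by omega)]
    · have := (Nat.div_le_self (N m) (2 ^ t)).trans (hN m)
      simp
      omega
  · exact ⟨h2.1, fun r hr => by rw [h2.2.1 r hr, if_pos (Nat.zero_le r)], h2.2.2⟩
  · simp
    have : numRow γ σ * (n * 21 + 29 + 9) ≤ numRow γ σ * (n * 21 + 40) :=
      Nat.mul_le_mul_left _ (by omega)
    omega

theorem reach_lt (γ σ mode : ℕ) (N : ℕ → ℕ) : ∀ t, reach γ σ mode N t < 2 ^ stateBound γ σ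
  | 0 => bitset_lt _ _
  | _ + 1 => bitset_lt _ _

theorem levelMask_lt (γ σ : ℕ) (N : ℕ → ℕ) (t : ℕ) : levelMask γ σ N t < 2 ^ numRow γ σ := by
  rw [levelMask, bits_eq, mul_zero, add_zero]
  exact ofDig_lt fun i _ => Nat.mod_lt _ (by omega)

/-- State sets and level masks are bounded in the parameter at every level, so each call of the
transition is charged the same `T b`. Only halving the right-hand sides costs time depending on n.
-/
theorem runs_levelLoop {T : ℕ → ℕ} {b mode : ℕ} {init step : Program}
    (hinit : Call (fun γ σ _ _ => initSet γ σ mode) T init 11 12 11 11 27)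
    (hstep : Call (fun γ σ S m => stepSet γ σ S m) T step 11 12 27 28 27)
    (hs : Ready I s) (hσ : I.maxSize ≤ b) (hγ : I.γ ≤ b)
    (hS : 2 ^ stateBound I.γ I.maxSize ≤ b) (hm : 2 ^ I.R ≤ b)
    (h5 : ∀ r < I.R, s 5 r = I.rhs r) :
    Runs O (levelLoop init step) s (7 + T b + I.n * (I.R * (I.n * 21 + 40) + T b + 20)) fun s' =>
      Ready I s' ∧ s' 27 0 = reach I.γ I.maxSize mode I.rhs I.n := by
  set l := [5, 27, 28, 29, 30, 31, 32, 33] with hl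
  have hr : ∀ s', Frame l s s' → Ready I s' := fun s' hf => hs.frame hf (by decide)
  set J : ℕ → Memory → Prop := fun m t =>
    t 27 0 = reach I.γ I.maxSize mode I.rhs (I.n - m) ∧
    (∀ r < I.R, t 5 r = I.rhs r / 2 ^ (I.n - m)) ∧ Frame l s t with hJ
  refine (((hinit O s b ?_ ?_ ?_ ?_).mono le_rfl (R := J I.n) fun s1 h1 => ?_).seq fun s1 h1 =>
    (Runs.forDown (N := I.n) (T := 10 + I.R * (I.n * 21 + 40) + T b) J ?_ ?_ h1 ?_).mono le_rfl
      fun s2 h2 => ⟨hr _ h2.2.2, by simpa using h2.1⟩).mono ?_ fun _ h => h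
  · rw [hs.γ]; exact hγ
  · rw [hs.σ]; exact hσ
  · rw [hs.γ]; exact hγ
  · rw [hs.γ]; exact hγ
  · refine ⟨by rw [h1.1, hs.γ, hs.σ, Nat.sub_self, reach], fun r hr => ?_, h1.2.mono (by decide)⟩
    rw [h1.2 5 (by decide) (by decide), h5 r hr, Nat.sub_self, pow_zero, Nat.div_one]
  · simp [(hr s1 h1.2.2).n]
  · rintro m - t w ⟨h1, h2, h3⟩
    exact ⟨by rw [Memory.set_of_ne _ _ _ (by decide), h1],
      by rw [Memory.set_of_ne _ _ _ (by decide)]; exact h2, h3.set (by decide) _ _⟩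
  · rintro m hmn t ⟨h1, h2, h3⟩ h29
    have e : I.n - m = I.n - (m + 1) + 1 := by omega
    refine ((runs_maskLoop I.rhs_le (hr t h3).R h2).seq fun t1 ht1 =>
      (hstep O t1 b ?_ ?_ ?_ ?_).mono le_rfl fun t2 ht2 => ?_).mono
      (by simp only [Instance.R]; omega) fun _ h => h
    all_goals have hf1 := h3.trans (ht1.2.2.mono (l' := l) (by decide))
    all_goals have e27 : t1 27 0 = reach I.γ I.maxSize mode I.rhs (I.n - (m + 1)) := by
                rw [ht1.2.2 27 (by decide) (by decide), h1]
    · rw [(hr t1 hf1).γ]; exact hγ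
    · rw [(hr t1 hf1).σ]; exact hσ
    · rw [e27]; exact (reach_lt _ _ _ _ _).le.trans hS
    · rw [ht1.1]; exact (levelMask_lt _ _ _ _).le.trans hm
    · refine ⟨?_, ?_, fun r hr => ?_, hf1.trans (ht2.2.mono (by decide))⟩
      · rw [ht2.2 29 (by decide) (by decide), ht1.2.2 29 (by decide) (by decide), h29]
      · rw [ht2.1, (hr t1 hf1).γ, (hr t1 hf1).σ, e27, ht1.1, e, reach]
      · rw [ht2.2 5 (by decide) (by decide), ht1.2.1 r hr, e]
  · simp
    have : I.n * (10 + I.R * (I.n * 21 + 40) + T b + 9)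
        ≤ I.n * (I.R * (I.n * 21 + 40) + T b + 20) := Nat.mul_le_mul_left _ (by omega)
    omega

end Correctness

/-! ### Total running time and assembly of the program -/

theorem Call.mono {F : ℕ → ℕ → ℕ → ℕ → ℕ} {T T' : ℕ → ℕ} {p : Program} {x y z w out : ℕ}
    (h : Call F T p x y z w out) (hT : ∀ b, T b ≤ T' b) : Call F T' p x y z w out :=
  fun O s b hx hy hz hw => (h O s b hx hy hz hw).mono (hT b) fun _ h => h

theorem kindTime_le {n V T B : ℕ} (hn : 1 ≤ n) (hV : V ≤ B) (hT : T ≤ B) (hB : 1 ≤ B) :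
    kindTime n V T + 9 ≤ 236 * (n * B ^ 3) := by
  have hnB : 1 ≤ n * B := Nat.mul_pos hn hB
  have h1 : pairTime n T + 9 ≤ 191 * (n * B) := by
    have : n * (2 * (T + 60)) ≤ n * (122 * B) := Nat.mul_le_mul_left _ (by omega)
    unfold pairTime
    linarith
  have h2 : 16 + V * (pairTime n T + 9) ≤ 207 * (n * B ^ 2) := by
    have := Nat.mul_le_mul hV h1
    have h3 : 1 ≤ n * B ^ 2 := Nat.mul_pos hn (by positivity)
    linarith [show B * (191 * (n * B)) = 191 * (n * B ^ 2) by ring]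
  have h4 := Nat.mul_le_mul hV h2
  have h5 : 1 ≤ n * B ^ 3 := Nat.mul_pos hn (by positivity)
  unfold kindTime
  linarith [show B * (207 * (n * B ^ 2)) = 207 * (n * B ^ 3) by ring]

/-- The dominant term is the computation of kinds: n agents, V² pairs of profiles, and a pass over n
agents with a compiled test for each. This explains B³ · n². -/
theorem total_time_le {n V R T B : ℕ} (hn : 1 ≤ n) (hV : V ≤ B) (hR : R ≤ B) (hT : T ≤ B)
    (hB : 1 ≤ B) :
    12 + 2 * T + (10 + n * 40 + (40 + n * (kindTime n V T + 9) +
      (7 + T + n * (R * (n * 21 + 40) + T + 20) + T))) ≤ 1000 * B ^ 3 * n ^ 2 := by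
  have h1 := Nat.mul_le_mul_left n (kindTime_le hn hV hT hB)
  have h2 : R * (n * 21 + 40) ≤ B * (61 * n) := Nat.mul_le_mul hR (by omega)
  have h3 : n * (R * (n * 21 + 40) + T + 20) ≤ n * (82 * (n * B)) := by
    refine Nat.mul_le_mul_left n ?_
    have h4 : B ≤ n * B := Nat.le_mul_of_pos_left B hn
    linarith [show B * (61 * n) = 61 * (n * B) by ring]
  have h4 : B ≤ B ^ 3 := Nat.le_self_pow (by omega) B
  have h5 : n ≤ n ^ 2 := Nat.le_self_pow (by omega) n
  have h6 : B ^ 3 ≤ B ^ 3 * n ^ 2 := Nat.le_mul_of_pos_right _ (by positivity)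
  have h7 : n ^ 2 ≤ B ^ 3 * n ^ 2 := Nat.le_mul_of_pos_left _ (by positivity)
  have h8 : n ^ 2 * B ≤ n ^ 2 * B ^ 3 := Nat.mul_le_mul_left _ h4
  linarith [show n * (236 * (n * B ^ 3)) = 236 * (B ^ 3 * n ^ 2) by ring,
    show n * (82 * (n * B)) = 82 * (n ^ 2 * B) by ring,
    show n ^ 2 * B ^ 3 = B ^ 3 * n ^ 2 by ring]

open Classical in
/-- The integer program of an instance is solved in fixed-parameter time. -/
theorem exists_program_solvable (mode : ℕ) :
    ∃ (p : Program) (f : ℕ → ℕ) (c : ℕ), Computable f ∧ ∀ I : Instance, ∃ (t : ℕ) (s : Memory),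
      Exec I.oracle p I.input t s ∧ t ≤ f (I.γ + I.maxSize) * I.n ^ c ∧
      s 2 0 = if Solvable I.γ I.maxSize mode I.rhs then 1 else 0 := by
  obtain ⟨Tv, pTv, -, -, cTv⟩ := exists_call (F := fun γ σ _ _ => numProf γ σ) (by fun_prop)
  obtain ⟨Tr, pTr, -, -, cTr⟩ := exists_call (F := fun γ σ _ _ => numRow γ σ) (by fun_prop)
  obtain ⟨Tt, pTt, -, -, cTt⟩ := exists_call (F := fun σ v c a => repTest σ v c a)
    (primrec_repTest (by fun_prop) (by fun_prop) (by fun_prop) (by fun_prop))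
  obtain ⟨Ti, pTi, -, -, cTi⟩ := exists_call (F := fun γ σ _ _ => initSet γ σ mode)
    (primrec_initSet mode (by fun_prop) (by fun_prop))
  obtain ⟨Ts, pTs, -, -, cTs⟩ := exists_call (F := fun γ σ S m => stepSet γ σ S m)
    (primrec_stepSet (by fun_prop) (by fun_prop) (by fun_prop) (by fun_prop))
  obtain ⟨Ta, pTa, -, -, cTa⟩ := exists_call
    (F := fun γ σ S _ => if Accepting γ σ S then 1 else 0)
    (primrec_accepting (by fun_prop) (by fun_prop) (by fun_prop))
  -- Only the value bound is used here. Evaluated at γ + σ, it dominates all parameter quantities by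
  -- a primitive recursive function of the sum alone.
  obtain ⟨Tb, pTb, -, vTb, -⟩ := exists_call (F := fun γ σ _ _ =>
    2 ^ stateBound γ σ + 2 ^ numRow γ σ + numProf γ σ + γ + σ + 1) (by fun_prop)
  set T : ℕ → ℕ := fun b => Tv b + Tr b + Tt b + Ti b + Ts b + Ta b with hT
  obtain ⟨profs, hprofs⟩ := cTv 11 12 11 11 13 (by decide) (by decide) (by decide) (by decide)
    (by decide)
  obtain ⟨rows, hrows⟩ := cTr 11 12 11 11 14 (by decide) (by decide) (by decide) (by decide)
    (by decide)
  obtain ⟨test1, htest1⟩ := cTt 12 17 24 25 26 (by decide) (by decide) (by decide) (by decide)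
    (by decide)
  obtain ⟨test2, htest2⟩ := cTt 12 18 24 25 26 (by decide) (by decide) (by decide) (by decide)
    (by decide)
  obtain ⟨init, hinit⟩ := cTi 11 12 11 11 27 (by decide) (by decide) (by decide) (by decide)
    (by decide)
  obtain ⟨step, hstep⟩ := cTs 11 12 27 28 27 (by decide) (by decide) (by decide) (by decide)
    (by decide)
  obtain ⟨acc, hacc⟩ := cTa 11 12 27 11 2 (by decide) (by decide) (by decide) (by decide)
    (by decide)
  replace hprofs := hprofs.mono (T' := T) fun b => by simp only [hT]; omega
  replace hrows := hrows.mono (T' := T) fun b => by simp only [hT]; omega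
  replace htest1 := htest1.mono (T' := T) fun b => by simp only [hT]; omega
  replace htest2 := htest2.mono (T' := T) fun b => by simp only [hT]; omega
  replace hinit := hinit.mono (T' := T) fun b => by simp only [hT]; omega
  replace hstep := hstep.mono (T' := T) fun b => by simp only [hT]; omega
  replace hacc := hacc.mono (T' := T) fun b => by simp only [hT]; omega
  have pT : Primrec T := by fun_prop
  refine ⟨decideProgram profs rows test1 test2 init step acc,
    fun k => 1000 * (T (Tb k) + Tb k + 1) ^ 3, 2, ?_, fun I => ?_⟩
  · have : Primrec fun k => 1000 * (T (Tb k) + Tb k + 1) ^ 3 := by fun_prop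
    exact this.to_comp
  set b := Tb (I.γ + I.maxSize) with hb
  have hbound := vTb I.γ I.maxSize 0 0 (I.γ + I.maxSize) (by omega) (by omega) (by omega)
    (by omega)
  rw [← hb] at hbound
  have hRlt : I.R < 2 ^ I.R := Nat.lt_two_pow_self
  obtain ⟨hS, hm, hV, hR, hγ, hσ⟩ : 2 ^ stateBound I.γ I.maxSize ≤ b ∧ 2 ^ I.R ≤ b ∧ I.V ≤ b ∧
      I.R ≤ b ∧ I.γ ≤ b ∧ I.maxSize + 1 ≤ b := by
    unfold Instance.R Instance.V at *
    generalize 2 ^ stateBound I.γ I.maxSize = X at *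
    generalize 2 ^ numRow I.γ I.maxSize = Y at *
    omega
  clear hbound hRlt
  have hin : ∀ A, 2 ≤ A → ∀ j, I.input A j = 0 := fun A hA j => by
    simp [Instance.input, show A ≠ 0 by omega, show A ≠ 1 by omega]
  have hsetup : Runs I.oracle (.seq (assign 11 (.read 0 (.const 1)))
      (.seq (assign 12 (.read 0 (.const 2))) (.seq (assign 34 (.read 0 (.const 0)))
      (.seq profs rows)))) I.input (12 + 2 * T b) fun s => s 11 0 = I.γ ∧ s 12 0 = I.maxSize ∧
        s 34 0 = I.n ∧ s 13 0 = I.V ∧ s 14 0 = I.R ∧ Frame [11, 12, 13, 14, 34] I.input s := by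
    refine ((Runs.assign (Q := fun s => s 11 0 = I.γ ∧ Frame [11, 12, 13, 14, 34] I.input s)
      ?_).seq fun s1 h1 => (Runs.assign (Q := fun s => s 11 0 = I.γ ∧ s 12 0 = I.maxSize ∧
        Frame [11, 12, 13, 14, 34] I.input s) ?_).seq fun s2 h2 =>
      (Runs.assign (Q := fun s => s 11 0 = I.γ ∧ s 12 0 = I.maxSize ∧ s 34 0 = I.n ∧
        Frame [11, 12, 13, 14, 34] I.input s) ?_).seq fun s3 h3 =>
      (hprofs I.oracle s3 b ?_ ?_ ?_ ?_).seq fun s4 h4 =>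
      (hrows I.oracle s4 b ?_ ?_ ?_ ?_).mono le_rfl fun s5 h5 => ?_).mono ?_ fun _ h => h
    · exact ⟨by simp [Memory.set_apply, Instance.input],
        (Frame.refl _ _).set (by decide) _ _⟩
    · exact ⟨by simp [Memory.set_apply, h1.1],
        by simp [Memory.set_apply, h1.2 0 (by decide) (by decide), Instance.input],
        h1.2.set (by decide) _ _⟩
    · exact ⟨by simp [Memory.set_apply, h2.1], by simp [Memory.set_apply, h2.2.1],
        by simp [Memory.set_apply, h2.2.2 0 (by decide) (by decide), Instance.input],
        h2.2.2.set (by decide) _ _⟩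
    · rw [h3.1]; omega
    · rw [h3.2.1]; omega
    · rw [h3.1]; omega
    · rw [h3.1]; omega
    · rw [h4.2 11 (by decide) (by decide), h3.1]; omega
    · rw [h4.2 12 (by decide) (by decide), h3.2.1]; omega
    · rw [h4.2 11 (by decide) (by decide), h3.1]; omega
    · rw [h4.2 11 (by decide) (by decide), h3.1]; omega
    · refine ⟨?_, ?_, ?_, ?_, ?_, h3.2.2.2.trans ((h4.2.mono (by decide)).trans
        (h5.2.mono (by decide)))⟩
      · rw [h5.2 11 (by decide) (by decide), h4.2 11 (by decide) (by decide), h3.1]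
      · rw [h5.2 12 (by decide) (by decide), h4.2 12 (by decide) (by decide), h3.2.1]
      · rw [h5.2 34 (by decide) (by decide), h4.2 34 (by decide) (by decide), h3.2.2.1]
      · rw [h5.2 13 (by decide) (by decide), h4.1, h3.1, h3.2.1]
      · rw [h5.1, h4.2 11 (by decide) (by decide), h4.2 12 (by decide) (by decide), h3.1,
          h3.2.1]
    · simp
      omega
  have hmain : Runs I.oracle (decideProgram profs rows test1 test2 init step acc) I.input
      (12 + 2 * T b + (10 + I.n * 40 + (40 + I.n * (kindTime I.n I.V (T b) + 9) +
        (7 + T b + I.n * (I.R * (I.n * 21 + 40) + T b + 20) + T b))))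
      fun s => s 2 0 = if Solvable I.γ I.maxSize mode I.rhs then 1 else 0 := by
    refine hsetup.seq fun s1 ⟨h11, h12, h34, h13, h14, hf⟩ => (runs_rankLoop (I := I)
      (hf 1 (by decide) (by decide)) h34 fun c => ?_).seq fun s2 ⟨hrank, hf2⟩ =>
      (runs_countLoop (b := b) htest1 htest2 (I := I) ?_ hV hσ hγ
        fun A => ?_).seq fun s3 ⟨h3, hN⟩ =>
      (runs_levelLoop (b := b) hinit hstep h3 (by omega) hγ hS hm hN).seq fun s4 ⟨h4, hreach⟩ =>
      (hacc I.oracle s4 b ?_ ?_ ?_ ?_).mono le_rfl fun s5 h5 => ?_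
    · rw [hf 4 (by decide) (by decide), hin 4 (by decide)]
    · constructor
      · rw [hf2 0 (by decide) (by decide), hf 0 (by decide) (by decide)]
      · rw [hf2 1 (by decide) (by decide), hf 1 (by decide) (by decide)]
      · exact hrank
      · rw [hf2 11 (by decide) (by decide), h11]
      · rw [hf2 12 (by decide) (by decide), h12]
      · rw [hf2 13 (by decide) (by decide), h13]
      · rw [hf2 14 (by decide) (by decide), h14]
      · rw [hf2 34 (by decide) (by decide), h34]
    · rw [hf2 5 (by decide) (by decide), hf 5 (by decide) (by decide), hin 5 (by decide)]
    · rw [h4.γ]; omega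
    · rw [h4.σ]; omega
    · rw [hreach]
      exact (reach_lt I.γ I.maxSize mode I.rhs I.n).le.trans hS
    · rw [h4.γ]; omega
    · rw [h5.1, h4.γ, h4.σ, hreach]
      -- Reading n levels suffices because the right-hand side is at most n < 2 ^ n.
      simp only [accepting_reach_iff fun r _ => (I.rhs_le r).trans_lt Nat.lt_two_pow_self]
  obtain ⟨t, s, hexec, ht, hs⟩ := hmain
  exact ⟨t, s, hexec, ht.trans (total_time_le (B := T b + b + 1) I.n_pos (by omega) (by omega)
    (by omega) (by omega)), hs⟩

/-! ### Codes of coalitions -/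

/-- Grouping the summands by the value of `f` turns the sum into a digit expansion whose digits are
fiber sizes. Profile codes and configurations are both of this form. -/
theorem sum_pow_eq_ofDig {α : Type*} (C : Finset α) (f : α → ℕ) {m : ℕ} (b : ℕ)
    (hf : ∀ i ∈ C, f i < m) :
    ∑ i ∈ C, b ^ f i = ofDig b (fun x => (C.filter fun i => f i = x).card) m := by
  rw [ofDig, ← Finset.sum_fiberwise_of_maps_to (t := range m) (g := f) (by simpa using hf)]
  refine Finset.sum_congr rfl fun x _ => ?_
  rw [Finset.sum_congr rfl (g := fun _ => b ^ x) fun i hi => by rw [(mem_filter.1 hi).2]]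
  simp

theorem ofDig_dig {b : ℕ} : ∀ {m a : ℕ}, a < b ^ m → ofDig b (dig b a) m = a
  | 0, a, h => by
    have : a = 0 := by simpa using h
    simp [ofDig, this]
  | m + 1, a, h => by
    rw [ofDig_succ_bot]
    have h1 : a / b < b ^ m := Nat.div_lt_of_lt_mul (by rwa [pow_succ'] at h)
    have h2 := ofDig_dig h1
    have h3 : ofDig b (fun i => dig b a (i + 1)) m = ofDig b (dig b (a / b)) m :=
      ofDig_congr fun i _ => by rw [dig, dig, pow_succ', Nat.div_div_eq_div_mul]
    rw [h3, h2, dig, pow_zero, Nat.div_one, Nat.mod_add_div]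

namespace Instance
variable (I : Instance)

def colorClass (c : Fin I.γ) : Finset (Fin I.n) := univ.filter fun j => I.color j = c

theorem rank_lt_rank {j k : Fin I.n} (h : j < k) (hc : I.color j = I.color k) :
    I.rank k < I.rank j := by
  refine card_lt_card ⟨fun x hx => ?_, fun hsub => ?_⟩
  · simp only [mem_filter, mem_univ, true_and] at hx ⊢
    exact ⟨h.trans hx.1, hx.2.trans hc.symm⟩
  · have : k ∈ univ.filter fun j' => k < j' ∧ I.color j' = I.color k :=
      hsub (by simp [h, hc])
    simp at this

theorem rank_injOn (c : Fin I.γ) : Set.InjOn I.rank (I.colorClass c) := by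
  intro j hj k hk h
  simp only [colorClass, coe_filter, mem_univ, true_and, Set.mem_ofPred_eq] at hj hk
  rcases lt_trichotomy j k with hlt | he | hlt
  · exact absurd h (I.rank_lt_rank hlt (hj.trans hk.symm)).ne'
  · exact he
  · exact absurd h (I.rank_lt_rank hlt (hk.trans hj.symm)).ne

/-- Ranks are injective on a color class and smaller than its size, so they fill an initial segment.
Hence bounding the rank by t selects exactly t agents whenever the class has that many. -/
theorem image_rank (c : Fin I.γ) :
    (I.colorClass c).image I.rank = range (I.colorClass c).card := by
  refine eq_of_subset_of_card_le (fun x hx => ?_) ?_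
  · obtain ⟨j, hj, rfl⟩ := mem_image.1 hx
    simp only [colorClass, mem_filter, mem_univ, true_and] at hj
    refine mem_range.2 (card_lt_card ⟨fun k hk => ?_, fun hsub => ?_⟩)
    · simp only [colorClass, mem_filter, mem_univ, true_and] at hk ⊢
      exact hk.2.trans hj
    · have := hsub (show j ∈ I.colorClass c by simp [colorClass, hj])
      simp at this
  · rw [card_range, card_image_of_injOn (I.rank_injOn c)]

theorem card_rank_lt (c : Fin I.γ) {t : ℕ} (ht : t ≤ (I.colorClass c).card) :
    ((I.colorClass c).filter fun j => I.rank j < t).card = t := by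
  rw [← card_image_of_injOn ((I.rank_injOn c).mono
      fun j hj => (mem_filter.1 (mem_coe.1 hj)).1),
    show ((I.colorClass c).filter fun j => I.rank j < t).image I.rank =
      ((I.colorClass c).image I.rank).filter (· < t) by
        ext x; simp only [mem_image, mem_filter]; constructor
        · rintro ⟨j, ⟨h1, h2⟩, rfl⟩; exact ⟨⟨j, h1, rfl⟩, h2⟩
        · rintro ⟨⟨j, h1, rfl⟩, h2⟩; exact ⟨j, ⟨h1, h2⟩, rfl⟩, image_rank]
  have : (range (I.colorClass c).card).filter (· < t) = range t := by
    ext x; simp only [mem_filter, mem_range]; omega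
  rw [this, card_range]

/-- The code of the profile of a coalition. -/
def code (C : Finset (Fin I.n)) : ℕ := ∑ j ∈ C, (I.maxSize + 2) ^ (I.color j : ℕ)

/-- The configuration of a coalition: how many members of each kind it has. -/
noncomputable def conf (C : Finset (Fin I.n)) : ℕ := ∑ j ∈ C, (I.maxSize + 1) ^ I.kind j

variable {I}

theorem code_eq (C : Finset (Fin I.n)) : I.code C =
    ofDig (I.maxSize + 2) (fun x => (C.filter fun i => (I.color i : ℕ) = x).card) I.γ :=
  sum_pow_eq_ofDig C _ _ fun i _ => (I.color i).2

theorem code_lt {C : Finset (Fin I.n)} (h : C.card ≤ I.maxSize + 1) : I.code C < I.V := by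
  rw [code_eq]
  exact ofDig_lt fun _ _ => ((card_filter_le _ _).trans h).trans_lt (by omega)

/-- The coalition itself witnesses that each color class is large enough. Codes that no coalition
realizes may be represented wrongly, but stability never looks at them. -/
theorem card_rep_code {C : Finset (Fin I.n)} (h : C.card ≤ I.maxSize + 1) (c : Fin I.γ) :
    ((I.rep (I.code C)).filter fun i => I.color i = c).card =
      (C.filter fun i => I.color i = c).card := by
  have h1 : dig (I.maxSize + 2) (I.code C) c = (C.filter fun i => I.color i = c).card := by
    rw [code_eq, dig_ofDig (fun _ _ => ((card_filter_le _ _).trans h).trans_lt (by omega)) c.2]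
    simp only [Fin.ext_iff]
  rw [← h1, ← I.card_rank_lt c (t := dig (I.maxSize + 2) (I.code C) c)]
  · congr 1
    ext j
    simp only [rep, colorClass, mem_filter, mem_univ, true_and]
    constructor
    · rintro ⟨h2, rfl⟩; exact ⟨rfl, h2⟩
    · rintro ⟨rfl, h2⟩; exact ⟨h2, rfl⟩
  · rw [h1]
    exact card_le_card (filter_subset_filter _ (subset_univ _))

theorem card_eq_of_color {C D : Finset (Fin I.n)}
    (h : ∀ c, (C.filter fun i => I.color i = c).card = (D.filter fun i => I.color i = c).card) :
    C.card = D.card := by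
  rw [card_eq_sum_card_fiberwise (f := I.color) (t := univ) (by simp [Set.MapsTo]),
    card_eq_sum_card_fiberwise (s := D) (f := I.color) (t := univ) (by simp [Set.MapsTo])]
  exact Finset.sum_congr rfl fun c _ => h c

theorem weaklyPrefers_congr {C C' D D' : Finset (Fin I.n)} (i : Fin I.n)
    (h : ∀ c, (C.filter fun i => I.color i = c).card = (C'.filter fun i => I.color i = c).card)
    (h' : ∀ c, (D.filter fun i => I.color i = c).card = (D'.filter fun i => I.color i = c).card) :
    I.WeaklyPrefers i C D ↔ I.WeaklyPrefers i C' D' := by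
  have e : ∀ {C C' : Finset (Fin I.n)}, (∀ c, (C.filter fun i => I.color i = c).card =
      (C'.filter fun i => I.color i = c).card) → palette I.color C = palette I.color C' :=
    fun h => funext fun c => by rw [palette, palette, h c, card_eq_of_color h]
  have e1 := e h
  have e2 := e h'
  have n1 : C.Nonempty ↔ C'.Nonempty := by
    rw [← card_pos, ← card_pos, card_eq_of_color h]
  have n2 : D.Nonempty ↔ D'.Nonempty := by
    rw [← card_pos, ← card_pos, card_eq_of_color h']
  simp only [WeaklyPrefers, e1, e2, n1, n2]

theorem prefBit_le (i : Fin I.n) (q : ℕ) : I.prefBit i q < 2 := by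
  unfold prefBit; split_ifs <;> omega

theorem dig_kind (i : Fin I.n) {q : ℕ} (hq : q < I.V * I.V) :
    dig 2 (I.kind i) q = I.prefBit i q := by
  rw [kind, bits_eq, dig_ofDig_add _ (fun _ _ => I.prefBit_le i _) hq, zero_add]

theorem kindColor_kind (i : Fin I.n) : kindColor I.γ I.maxSize (I.kind i) = I.color i := by
  rw [kindColor, kind, bits_eq]
  exact ofDig_add_div 2 (fun _ _ => I.prefBit_le i _) _

theorem kind_lt (i : Fin I.n) : I.kind i < numKind I.γ I.maxSize := by
  have h1 := I.kindColor_kind i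
  have h2 := (I.color i).2
  rw [← h1, kindColor] at h2
  exact (Nat.div_lt_iff_lt_mul (by positivity)).1 h2

/-- Preferences depend on palettes, which are functions of the color counts, so the coalitions can
be replaced by the representatives that the oracle was asked about. -/
theorem weaklyPrefers_iff (i : Fin I.n) {C D : Finset (Fin I.n)}
    (hC : C.card ≤ I.maxSize + 1) (hD : D.card ≤ I.maxSize + 1) :
    I.WeaklyPrefers i C D ↔ dig 2 (I.kind i) (I.code C * I.V + I.code D) = 1 := by
  have h1 := code_lt hC
  have h2 := code_lt hD
  have hlt : I.code C * I.V + I.code D < I.V * I.V := by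
    have := Nat.mul_le_mul_right I.V (Nat.succ_le_of_lt h1)
    rw [Nat.succ_mul] at this
    omega
  have hdiv : (I.code C * I.V + I.code D) / I.V = I.code C := by
    rw [mul_comm, Nat.mul_add_div (by omega), Nat.div_eq_of_lt h2, add_zero]
  have hmod : (I.code C * I.V + I.code D) % I.V = I.code D := by
    rw [mul_comm, Nat.mul_add_mod, Nat.mod_eq_of_lt h2]
  rw [dig_kind i hlt, prefBit, hdiv, hmod,
    ← weaklyPrefers_congr i (card_rep_code hC) (card_rep_code hD)]
  split_ifs <;> simp_all

theorem conf_eq (C : Finset (Fin I.n)) : I.conf C =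
    ofDig (I.maxSize + 1) (fun x => (C.filter fun i => I.kind i = x).card)
      (numKind I.γ I.maxSize) :=
  sum_pow_eq_ofDig C _ _ fun i _ => kind_lt i

theorem conf_lt {C : Finset (Fin I.n)} (h : C.card ≤ I.maxSize) :
    I.conf C < numConf I.γ I.maxSize := by
  rw [conf_eq]
  exact ofDig_lt fun _ _ => ((card_filter_le _ _).trans h).trans_lt (by omega)

theorem dig_conf {C : Finset (Fin I.n)} (h : C.card ≤ I.maxSize) {A : ℕ}
    (hA : A < numKind I.γ I.maxSize) :
    dig (I.maxSize + 1) (I.conf C) A = (C.filter fun i => I.kind i = A).card := by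
  rw [conf_eq, dig_ofDig (fun _ _ => ((card_filter_le _ _).trans h).trans_lt (by omega)) hA]

theorem confSize_conf {C : Finset (Fin I.n)} (h : C.card ≤ I.maxSize) :
    confSize I.γ I.maxSize (I.conf C) = C.card := by
  rw [confSize, Finset.sum_congr rfl fun A hA => dig_conf h (mem_range.1 hA)]
  exact (card_eq_sum_card_fiberwise fun i _ => by simpa using kind_lt i).symm

theorem confProf_conf {C : Finset (Fin I.n)} (h : C.card ≤ I.maxSize) :
    confProf I.γ I.maxSize (I.conf C) = I.code C := by
  rw [confProf, code, ← Finset.sum_fiberwise_of_maps_to (t := range (numKind I.γ I.maxSize))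
    (g := I.kind) fun i _ => by simpa using kind_lt i]
  refine Finset.sum_congr rfl fun A hA => ?_
  rw [dig_conf h (mem_range.1 hA), Finset.sum_congr rfl
    (g := fun _ => (I.maxSize + 2) ^ kindColor I.γ I.maxSize A) fun i hi => by
      rw [← kindColor_kind, (mem_filter.1 hi).2]]
  simp

/-! ### Stability of outcomes in terms of configurations -/

/-- Joining adds one power of σ + 2 to the code of the target, and all coalitions compared have at
most σ + 1 members, so the kinds contain every preference needed. -/
theorem confDeviation_iff (mode : ℕ) (i : Fin I.n) {C D : Finset (Fin I.n)}
    (hC : C.card ≤ I.maxSize) (hD : D.card ≤ I.maxSize) (hi : i ∉ C) :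
    ConfDeviation I.γ I.maxSize mode (I.conf D) (I.kind i) (I.conf C) ↔
      I.StrictlyPrefers i (insert i C) D ∧
        (mode = 0 ∨ ∀ j ∈ C, I.WeaklyPrefers j (insert i C) C) := by
  have hins : (insert i C).card ≤ I.maxSize + 1 := by rw [card_insert_of_notMem hi]; omega
  have hcode : I.code (insert i C) = I.code C + (I.maxSize + 2) ^ (I.color i : ℕ) := by
    rw [code, sum_insert hi, add_comm, code]
  unfold ConfDeviation KindStrict StrictlyPrefers
  rw [confProf_conf hC, confProf_conf hD, kindColor_kind, ← hcode,
    weaklyPrefers_iff i hins (by omega), weaklyPrefers_iff i (by omega) hins]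
  refine and_congr Iff.rfl (or_congr Iff.rfl ⟨fun h j hj => ?_, fun h B hB hB0 => ?_⟩)
  · rw [weaklyPrefers_iff j hins (by omega)]
    refine h _ (kind_lt j) ?_
    rw [dig_conf hC (kind_lt j)]
    exact (card_pos.2 ⟨j, by simp [hj]⟩).ne'
  · rw [dig_conf hC hB] at hB0
    obtain ⟨j, hj⟩ := card_pos.1 (Nat.pos_of_ne_zero hB0)
    obtain ⟨hj1, rfl⟩ := mem_filter.1 hj
    exact (weaklyPrefers_iff j hins (by omega)).1 (h j hj1)

/-- Nash stability for mode `0`, individual stability for the other modes. -/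
def StableMode (mode : ℕ) (P : I.Outcome) : Prop :=
  ∀ i C, ¬ (NSDeviation P i C ∧ (mode = 0 ∨ ∀ j ∈ C, I.WeaklyPrefers j (insert i C) C))

/-- The number of coalitions with configuration `a`. -/
noncomputable def confCount (P : I.Outcome) (a : ℕ) : ℕ :=
  (P.parts.filter fun C => I.conf C = a).card

/-- A deviation involves one agent, its coalition and one different target. Whether suitable
coalitions exist can be read off from multiplicities capped at 2. -/
theorem stableCode_iff {mode g : ℕ} {P : I.Outcome} (hP : ∀ C ∈ P.parts, C.card ≤ I.maxSize)
    (hg : ∀ a < numConf I.γ I.maxSize, dig 3 g a = min (confCount P a) 2) :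
    StableCode I.γ I.maxSize mode g ↔ StableMode mode P := by
  constructor
  · rintro h i C ⟨⟨hC, hs⟩, hm⟩
    have hpart : P.part i ∈ P.parts := P.part_mem.2 (mem_univ i)
    have hip : i ∈ P.part i := P.mem_part (mem_univ i)
    -- An agent never strictly gains by joining its own coalition, so the target differs from the
    -- source.
    have hiC : i ∉ C := fun hi => by
      rcases hC with hC | rfl
      · rw [P.part_eq_of_mem hC hi, insert_eq_of_mem hi] at hs
        exact hs.2 hs.1
      · simp at hi
    have hCc : C.card ≤ I.maxSize := by
      rcases hC with hC | rfl
      · exact hP C hC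
      · simp
    have hDc := hP _ hpart
    refine (h _ (conf_lt hDc) ?_).2 _ (kind_lt i) ?_ _ (conf_lt hCc) ?_
      ((confDeviation_iff mode i hCc hDc hiC).2 ⟨hs, hm⟩)
    · rw [hg _ (conf_lt hDc)]
      have : 0 < confCount P (I.conf (P.part i)) := card_pos.2 ⟨_, mem_filter.2 ⟨hpart, rfl⟩⟩
      omega
    · rw [dig_conf hDc (kind_lt i)]
      exact (card_pos.2 ⟨i, by simp [hip]⟩).ne'
    · rcases hC with hC | rfl
      · right
        rw [hg _ (conf_lt hCc)]
        have : 0 < confCount P (I.conf C) := card_pos.2 ⟨_, mem_filter.2 ⟨hC, rfl⟩⟩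
        refine ⟨by omega, fun he => ?_⟩
        have : 1 < confCount P (I.conf C) := one_lt_card.2 ⟨C, mem_filter.2 ⟨hC, rfl⟩, P.part i,
          mem_filter.2 ⟨hpart, he.symm⟩, fun e => hiC (e ▸ hip)⟩
        omega
      · left
        simp [conf]
  · intro h a ha ha0
    rw [hg a ha] at ha0
    obtain ⟨D, hDa⟩ := card_pos.1 (show 0 < confCount P a by omega)
    obtain ⟨hD, rfl⟩ := mem_filter.1 hDa
    have hDc := hP D hD
    rw [confSize_conf hDc]
    refine ⟨⟨(card_pos.2 (P.nonempty_of_mem_parts hD)).ne', hDc⟩, fun A hA hA0 b hb hb' hdev => ?_⟩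
    rw [dig_conf hDc hA] at hA0
    obtain ⟨i, hi⟩ := card_pos.1 (Nat.pos_of_ne_zero hA0)
    obtain ⟨hiD, rfl⟩ := mem_filter.1 hi
    have hpart : P.part i = D := P.part_eq_of_mem hD hiD
    -- The code only names a target configuration. An actual target other than `D` exists, with the
    -- cap value 2 supplying the second copy when the configurations agree.
    have key : ∃ C, (C ∈ P.parts ∨ C = ∅) ∧ I.conf C = b ∧ C ≠ D := by
      rcases hb' with rfl | ⟨h0, h2⟩
      · exact ⟨∅, .inr rfl, by simp [conf], (P.nonempty_of_mem_parts hD).ne_empty.symm⟩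
      · rw [hg b hb] at h0 h2
        by_cases he : b = I.conf D
        · have h3 : 1 < confCount P b := by have := h2 he; omega
          obtain ⟨C, hC, hne⟩ := exists_mem_ne h3 D
          exact ⟨C, .inl (mem_filter.1 hC).1, (mem_filter.1 hC).2, hne⟩
        · obtain ⟨C, hC⟩ := card_pos.1 (show 0 < confCount P b by omega)
          exact ⟨C, .inl (mem_filter.1 hC).1, (mem_filter.1 hC).2, fun e => he (by
            rw [← e, (mem_filter.1 hC).2])⟩
    obtain ⟨C, hC, rfl, hne⟩ := key
    have hiC : i ∉ C := fun hi => by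
      rcases hC with hC | rfl
      · exact hne ((P.part_eq_of_mem hC hi).symm.trans hpart)
      · simp at hi
    have hCc : C.card ≤ I.maxSize := by
      rcases hC with hC | rfl
      · exact hP C hC
      · simp
    obtain ⟨k1, k2⟩ := (confDeviation_iff mode i hCc hDc hiC).1 hdev
    exact h i C ⟨⟨hC, by rwa [hpart]⟩, k2⟩

theorem sum_confCount_mul {P : I.Outcome} (hP : ∀ C ∈ P.parts, C.card ≤ I.maxSize) (φ : ℕ → ℕ) :
    ∑ a ∈ range (numConf I.γ I.maxSize), confCount P a * φ a = ∑ C ∈ P.parts, φ (I.conf C) := by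
  rw [← Finset.sum_fiberwise_of_maps_to (t := range (numConf I.γ I.maxSize)) (g := I.conf)
    fun C hC => by simpa using conf_lt (hP C hC)]
  refine Finset.sum_congr rfl fun a _ => ?_
  rw [Finset.sum_congr rfl (g := fun _ => φ a) fun C hC => by rw [(mem_filter.1 hC).2]]
  simp [confCount]

theorem sum_confCount_coef {P : I.Outcome} (hP : ∀ C ∈ P.parts, C.card ≤ I.maxSize) (r : ℕ) :
    ∑ a ∈ range (numConf I.γ I.maxSize), confCount P a * coef I.γ I.maxSize a r =
      if r < numKind I.γ I.maxSize then (univ.filter fun i => I.kind i = r).card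
      else if r = numKind I.γ I.maxSize then P.parts.card
      else (P.parts.filter fun C => C.card ≠ 1).card := by
  rw [sum_confCount_mul hP fun a => coef I.γ I.maxSize a r]
  simp only [coef]
  split_ifs with h1 h2
  · rw [Finset.sum_congr rfl fun C hC => dig_conf (hP C hC) h1]
    rw [← card_biUnion (t := fun C => C.filter fun i => I.kind i = r) fun C hC D hD h =>
      Finset.disjoint_filter_filter (s := C) (t := D) (P.disjoint hC hD h)]
    conv_rhs => rw [← P.biUnion_parts, filter_biUnion]
    rfl
  · simp
  · rw [Finset.sum_congr rfl (g := fun C : Finset (Fin I.n) => if C.card ≠ 1 then 1 else 0)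
      fun C hC => by rw [confSize_conf (hP C hC), ite_not], card_eq_sum_ones, sum_filter]

/-! ### Outcomes with prescribed configurations -/

/-- Any bijection with the disjoint union of `d l` places for each `l` gives such a labeling; the
default label is used outside `s` only. -/
theorem exists_labeling {α Λ : Type*} [DecidableEq α] [Fintype Λ] [DecidableEq Λ] [Nonempty Λ]
    (s : Finset α) (d : Λ → ℕ) (h : ∑ l, d l = s.card) :
    ∃ f : α → Λ, ∀ l, (s.filter fun i => f i = l).card = d l := by
  classical
  have e : s ≃ Σ l, Fin (d l) := Fintype.equivOfCardEq (by simp [h])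
  refine ⟨fun i => if hi : i ∈ s then (e ⟨i, hi⟩).1 else Classical.arbitrary Λ, fun l => ?_⟩
  rw [← Fintype.card_fin (d l), ← Finset.card_univ, eq_comm]
  refine card_bij (fun u _ => (e.symm ⟨l, u⟩ : α)) (fun u _ => ?_) (fun u _ v _ huv => ?_)
    fun i hi => ?_
  · simp
  · simpa using huv
  · obtain ⟨his, hil⟩ := mem_filter.1 hi
    have hl : (e ⟨i, his⟩).1 = l := by simpa [his] using hil
    subst hl
    exact ⟨(e ⟨i, his⟩).2, mem_univ _, by simp⟩

/-- Create `z a` empty slots for each configuration and distribute the agents of each kind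
separately. The sums guarantee an exact fit, and positive sizes make the slots nonempty and hence
distinct coalitions. -/
theorem exists_outcome {z : ℕ → ℕ}
    (hz : ∀ a < numConf I.γ I.maxSize, z a ≠ 0 →
      confSize I.γ I.maxSize a ≠ 0 ∧ confSize I.γ I.maxSize a ≤ I.maxSize)
    (hsum : ∀ A < numKind I.γ I.maxSize, ∑ a ∈ range (numConf I.γ I.maxSize),
      z a * dig (I.maxSize + 1) a A = (univ.filter fun i => I.kind i = A).card) :
    ∃ P : I.Outcome, (∀ C ∈ P.parts, C.card ≤ I.maxSize) ∧
      ∀ a < numConf I.γ I.maxSize, confCount P a = z a := by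
  classical
  let Λ := Σ a : Fin (numConf I.γ I.maxSize), Fin (z a)
  have hsumΛ : ∀ A < numKind I.γ I.maxSize, ∑ l : Λ, dig (I.maxSize + 1) l.1 A =
      (univ.filter fun i => I.kind i = A).card := fun A hA => by
    rw [← hsum A hA, Fintype.sum_sigma, ← Fin.sum_univ_eq_sum_range
      (fun a => z a * dig (I.maxSize + 1) a A)]
    simp
  -- Some agent exists, and its kind has to be placed somewhere.
  have hne : Nonempty Λ := by
    by_contra hemp
    rw [not_nonempty_iff] at hemp
    have h1 := hsumΛ _ (kind_lt ⟨0, I.n_pos⟩)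
    rw [Fintype.sum_empty, eq_comm, card_eq_zero, filter_eq_empty_iff] at h1
    exact h1 (mem_univ _) rfl
  choose! f hf using fun A (hA : A < numKind I.γ I.maxSize) =>
    exists_labeling _ (fun l : Λ => dig (I.maxSize + 1) l.1 A) (hsumΛ A hA)
  set label : Fin I.n → Λ := fun i => f (I.kind i) i with hlabel
  set fiber : Λ → Finset (Fin I.n) := fun l => univ.filter fun i => label i = l with hfiber
  have hcount : ∀ l A, A < numKind I.γ I.maxSize →
      ((fiber l).filter fun i => I.kind i = A).card = dig (I.maxSize + 1) l.1 A := by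
    intro l A hA
    rw [← hf A hA l]
    congr 1
    ext i
    simp only [hfiber, hlabel, mem_filter, mem_univ, true_and]
    constructor
    · rintro ⟨h1, rfl⟩; exact ⟨rfl, h1⟩
    · rintro ⟨rfl, h1⟩; exact ⟨h1, rfl⟩
  have hconf : ∀ l, I.conf (fiber l) = l.1 := fun l => by
    rw [conf_eq, ofDig_congr fun A hA => hcount l A hA]
    exact ofDig_dig l.1.2
  have hcard : ∀ l, (fiber l).card = confSize I.γ I.maxSize l.1 := fun l => by
    rw [card_eq_sum_card_fiberwise (f := I.kind) (t := range (numKind I.γ I.maxSize))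
      fun i _ => by simpa using kind_lt i]
    exact Finset.sum_congr rfl fun A hA => hcount l A (mem_range.1 hA)
  have hsize := fun l : Λ => hz l.1 l.1.2 (Nat.ne_of_gt (Fin.pos l.2))
  have hfne : ∀ l, (fiber l).Nonempty := fun l => by
    rw [← card_pos, hcard]
    exact Nat.pos_of_ne_zero (hsize l).1
  have hinj : Function.Injective fiber := fun l l' h => by
    obtain ⟨i, hi⟩ := hfne l
    have hi' := hi
    rw [h] at hi'
    exact (mem_filter.1 hi).2.symm.trans (mem_filter.1 hi').2
  let P : I.Outcome :=
    { parts := univ.image fiber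
      supIndep := by
        rw [Finset.supIndep_iff_pairwiseDisjoint]
        intro C hC D hD hCD
        obtain ⟨l, -, rfl⟩ := mem_image.1 (mem_coe.1 hC)
        obtain ⟨l', -, rfl⟩ := mem_image.1 (mem_coe.1 hD)
        refine Finset.disjoint_left.2 fun i hi hi' => hCD ?_
        rw [← (mem_filter.1 hi).2, ← (mem_filter.1 hi').2]
      sup_parts := by
        ext i
        simp only [mem_univ, iff_true, Finset.mem_sup, mem_image, true_and, id]
        exact ⟨_, ⟨label i, rfl⟩, by simp [hfiber]⟩
      bot_notMem := by
        intro h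
        obtain ⟨l, -, hl⟩ := mem_image.1 h
        exact (hfne l).ne_empty hl }
  refine ⟨P, fun C hC => ?_, fun a ha => ?_⟩
  · obtain ⟨l, -, rfl⟩ := mem_image.1 hC
    rw [hcard]
    exact (hsize l).2
  · have h1 : (P.parts.filter fun C => I.conf C = a) =
        univ.image fun t : Fin (z a) => fiber ⟨⟨a, ha⟩, t⟩ := by
      ext C
      simp only [mem_filter, mem_image, mem_univ, true_and, P]
      constructor
      · rintro ⟨⟨⟨⟨a', ha'⟩, t⟩, rfl⟩, he⟩
        rw [hconf] at he
        subst he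
        exact ⟨t, rfl⟩
      · rintro ⟨t, rfl⟩
        exact ⟨⟨_, rfl⟩, hconf _⟩
    have h2 : Function.Injective fun t : Fin (z a) => fiber ⟨⟨a, ha⟩, t⟩ := fun t t' h =>
      eq_of_heq (Sigma.mk.inj (hinj h)).2
    rw [confCount, h1, card_image_of_injective _ h2, card_univ, Fintype.card_fin]

theorem solvable_iff (mode : ℕ) : Solvable I.γ I.maxSize mode I.rhs ↔
    ∃ P : I.Outcome, StableMode mode P ∧ Admissible P := by
  have hparts : ∀ P : I.Outcome, P.parts.card ≤ I.n := fun P => by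
    simpa using P.card_parts_le_card
  constructor
  · rintro ⟨g, y, hg, hy, hsum⟩
    have hmult := fun a => dig_lt (b := 3) (by omega) g a
    obtain ⟨P, hP, hcount⟩ := exists_outcome (I := I) (z := fun a => dig 3 g a + y a)
      (fun a ha ha0 => (hg a ha fun h0 => by
        have : y a ≠ 0 := by omega
        have := hy a ha this
        omega).1)
      fun A hA => by
        have := hsum A (by unfold numRow; omega)
        simp only [coef, rhs, if_pos hA] at this
        exact le_antisymm this.1 (this.2 hA)
    have hrow : ∀ r < I.R, ∑ a ∈ range (numConf I.γ I.maxSize),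
        confCount P a * coef I.γ I.maxSize a r ≤ I.rhs r := fun r hr => by
      rw [Finset.sum_congr rfl fun a ha => by rw [hcount a (mem_range.1 ha)]]
      exact (hsum r hr).1
    refine ⟨P, (stableCode_iff hP fun a ha => ?_).1 hg, ?_, ?_, hP⟩
    -- Extra multiplicity is allowed only where the capped value is 2, so capping the sum recovers
    -- `g`.
    · rw [hcount a ha]
      have h1 := hmult a
      by_cases h0 : y a = 0
      · omega
      · have := hy a ha h0
        omega
    · have := hrow (numKind I.γ I.maxSize) (by simp [numRow])
      rw [sum_confCount_coef hP] at this
      simp [rhs] at this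
      exact this.1
    · have := hrow (numKind I.γ I.maxSize + 1) (by simp [numRow])
      rw [sum_confCount_coef hP] at this
      simp [rhs] at this
      exact this.1
  · rintro ⟨P, hstable, h1, h2, hP⟩
    have hlt : ∀ a < numConf I.γ I.maxSize, min (confCount P a) 2 < 3 := fun a _ => by omega
    set g := ofDig 3 (fun a => min (confCount P a) 2) (numConf I.γ I.maxSize)
    have hg : ∀ a < numConf I.γ I.maxSize, dig 3 g a = min (confCount P a) 2 := fun a ha =>
      dig_ofDig hlt ha
    -- Each multiplicity splits into its cap at 2 and the excess.
    refine ⟨g, fun a => confCount P a - 2, (stableCode_iff hP hg).2 hstable, fun a ha h0 => ?_,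
      fun r hr => ?_⟩
    · rw [hg a ha]
      dsimp only at h0
      omega
    · have e : ∑ a ∈ range (numConf I.γ I.maxSize), (dig 3 g a + (confCount P a - 2)) *
          coef I.γ I.maxSize a r = ∑ a ∈ range (numConf I.γ I.maxSize),
          confCount P a * coef I.γ I.maxSize a r := Finset.sum_congr rfl fun a ha => by
        rw [hg a (mem_range.1 ha), show min (confCount P a) 2 + (confCount P a - 2)
          = confCount P a by omega]
      rw [e, sum_confCount_coef hP, rhs]
      have := hparts P
      have := card_filter_le P.parts fun C => C.card ≠ 1
      split_ifs with c1 c2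
      · simp
      · exact ⟨le_min h1 (by omega), fun h => absurd h c1⟩
      · exact ⟨le_min h2 (by omega), fun h => absurd h c1⟩

end Instance

/-! ### Conclusion for both notions of stability -/

theorem fixedParameterTractable_of_mode {Q : Instance → Prop} (mode : ℕ)
    (hQ : ∀ I, Q I ↔ ∃ P : I.Outcome, Instance.StableMode mode P ∧ Instance.Admissible P) :
    FixedParameterTractable Q fun I => I.γ + I.maxSize := by
  obtain ⟨p, f, c, hf, h⟩ := exists_program_solvable mode
  refine ⟨p, f, c, hf, fun I => ?_⟩
  obtain ⟨t, s, h1, h2, h3⟩ := h I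
  refine ⟨t, s, h1, h2, fun hq => ?_, fun hq => ?_⟩
  · rw [h3, if_pos (Instance.solvable_iff mode |>.2 ((hQ I).1 hq))]
  · rw [h3, if_neg fun hs => hq ((hQ I).2 (Instance.solvable_iff mode |>.1 hs))]

end HDG

theorem mainTheorem2 :
    HDG.FixedParameterTractable HDG.NashProblem (fun I => I.γ + I.maxSize) ∧
    HDG.FixedParameterTractable HDG.IndividualProblem (fun I => I.γ + I.maxSize) := by
  refine ⟨HDG.fixedParameterTractable_of_mode 0 fun I => ?_,
    HDG.fixedParameterTractable_of_mode 1 fun I => ?_⟩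
  · simp [HDG.NashProblem, HDG.Instance.StableMode, HDG.Instance.NashStable]
  · simp only [HDG.IndividualProblem, HDG.Instance.StableMode,
      HDG.Instance.IndividuallyStable, HDG.Instance.ISDeviation, one_ne_zero, false_or]
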